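/- **Setting.** Let $\mathbb S^3=\{y\in\mathbb R^4:|y|=3\}$, $R_{kl}=\frac13(y^k\partial_l-y^l\partial_k)$, and let $Z_1=R_{12}+R_{34}$, $Z_2=R_{23}+R_{14}$, $Z_3=R_{13}-R_{24}$, a global frame of $\mathbb S^3$, regarded as a time-independent frame tangent to the slices $\{t\}\times\mathbb S^3$ of $[0,T)\times\mathbb S^3$. For a finite, possibly empty, sequence $I=(i_1,\dots,i_N)$ with entries in $\{1,2,3\}$ put $|I|=N$, $L^I=\mathcal L_{Z_{i_1}}\cdots\mathcal L_{Z_{i_N}}$ (Lie derivatives of tensorfields on the slices; also written $Z^I$ on functions). Sums over $I_1+I_2=I$ or $I_1+I_2+I_3=I$ run over all ways to distribute the entries of $I$ among the ordered, possibly empty, $I_j$ while keeping their order (as in the Leibniz rule). Let $a>0$ be the scale factor on $[0,T)$: $a''=-\frac23a^{1/3}$, $a(0)=1$, $a'(0)=0$. The unknowns on $[0,T)\times\mathbb S^3$ are a Riemannian metric $G$ on the slices, a type $\binom11$ tensorfield $K$, trace-free and such that $G_{ac}K^c{}_b$ is symmetric, functions $\psi$ (rescaled lapse) and $P$ (rescaled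 time derivative of the scalar field), and a one-form $\omega$ (spatial derivative of the scalar field). $\nabla$, $\mathrm{div}$, $\Delta$, $\mathrm{Ric}$, $R$, $|\cdot|$ and $\#$ are those of $G$ (with $\mathrm{div}\,\omega=(G^{-1})^{ab}\nabla_a\omega_b$, $(\mathrm{div}\,K)_j=\nabla_aK^a{}_j$, $(\mathrm{div}^\#K)^i=(G^{-1})^{ab}\nabla_aK^i{}_b$), $\mathrm{Id}$ is the identity, $\cdot$ is the natural contraction, $\mathcal L_{\partial_t}$ is the (projected) Lie derivative along $\partial_t$, and $\kappa=\sqrt{2/3}$. They satisfy the rescaled Einstein-scalar field equations: * $a^{4/3}(R-\frac23)-|K|^2=2\kappa P+P^2+a^{4/3}|\omega|^2$, $\ \mathrm{div}\,K=-\kappa\omega-P\omega$, $\ \mathrm{div}^\#K=-\kappa\omega^\#-P\omega^\#$; * $\mathcal L_{\partial_t}G=-2a^{-1}G\cdot K-2a^{1/3}\psi\, G\cdot K+\frac23a^{1/3}a'\psi G$, $\ \mathcal L_{\partial_t}G^{-1}=2a^{-1}G^{-1}\cdot K+2a^{1/3}\psi\, G^{-1}\cdot K-\frac23a^{1/3}a'\psi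 G^{-1}$; * $\mathcal L_{\partial_t}K=-a^{5/3}\nabla^\#\nabla\psi+a^{1/3}(1+a^{4/3}\psi)(\mathrm{Ric}^\#-\frac29\mathrm{Id})+\frac13(a')^2a^{1/3}\psi\,\mathrm{Id}+\frac29a^{5/3}\psi\,\mathrm{Id}-a^{1/3}a'\psi K-a^{1/3}\omega^\#\otimes\omega-a^{5/3}\psi\,\omega^\#\otimes\omega$; * $\partial_tP=(1+a^{4/3}\psi)a^{1/3}\mathrm{div}\,\omega-\kappa a'a^{1/3}\psi-a^{1/3}a'\psi P+a^{5/3}\nabla^\#\psi\cdot\omega$; * $\mathcal L_{\partial_t}\omega=a^{-1}(1+a^{4/3}\psi)\nabla P+\kappa a^{1/3}\nabla\psi+a^{1/3}P\nabla\psi$; * $a^{8/3}\Delta\psi-a^{4/3}f\psi=2\kappa P+|K|^2+P^2$ with $f=(a')^2+\frac23a^{4/3}+|K|^2+2\kappa P+P^2$; * $a^{4/3}\Delta\psi-\tilde f\psi=R-\frac23-|\omega|^2$ with $\tilde f=(a')^2+\frac23a^{4/3}+a^{4/3}(R-\frac23)-a^{4/3}|\omega|^2$. The inhomogeneous terms of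 the $L^I$-commuted equations are (with $[A,B]=AB-BA$) * $B_P=-a'(Z^I\psi)P$, $\ B_\omega=P\,\nabla Z^I\psi$, $\ B_\psi=\sum_{I_1+I_2=I}\{L^{I_1}K\cdot L^{I_2}K+(Z^{I_1}P)(Z^{I_2}P)\}$, where $(M\cdot N)=M^a{}_bN^b{}_a$; * $J_P=-a'\sum_{I_1+I_2=I,\,|I_1|<|I|}(Z^{I_1}\psi)Z^{I_2}P+[L^I,\mathrm{div}]\omega+a^{4/3}[L^I,\psi\,\mathrm{div}]\omega+a^{4/3}\sum_{I_1+I_2+I_3=I}(L^{I_2}G^{-1})(\nabla Z^{I_1}\psi,L^{I_3}\omega)$; * $J_\omega=[L^I,\psi]\nabla P+[L^I,P]\nabla\psi$, $\ J_\psi=a^{4/3}[\Delta,Z^I]\psi+[Z^I,|K|^2]\psi+2\kappa[Z^I,P]\psi+[Z^I,P^2]\psi$. The scalar field energy current is the spacetime vectorfield $\mathbf J=J^0\partial_t+J$ with $$J^0=(Z^IP)^2+a^{4/3}|L^I\omega|^2,\qquad J=-2(1+a^{4/3}\psi)a^{1/3}(Z^IP)(L^I\omega)^\#,$$ and $\mathbf{Div}$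 denotes the covariant divergence of the Lorentzian metric $-dt^2+G$. **Claim.** Let $I$ be any such sequence and suppose that $(G,K,\psi,P,\omega)$ is a solution of these equations on $[0,T)\times\mathbb S^3$ of class $C^m$ with $m\ge|I|+2$. Then, on $[0,T)\times\mathbb S^3$, $$\begin{aligned}\mathbf{Div}\,\mathbf J+a'a^3\,\mathrm{div}\{(\nabla^\#Z^I\psi)Z^I\psi\}={}&\tfrac43a'a^{1/3}|L^I\omega|^2+a'a^3|\nabla Z^I\psi|^2+c\,|Z^I\psi|^2\\&+2\kappa a^{5/3}(L^I\omega)^\#\cdot\nabla Z^I\psi+\mathrm{Border}+\mathrm{Junk},\end{aligned}$$ where $$c=(a')^3a^{5/3}+\tfrac23a'a^3+a'a^{5/3}|K|^2+2\kappa a'a^{5/3}P+a'a^{5/3}P^2,$$ $$\begin{aligned}\mathrm{Border}={}&2a^{1/3}(Z^IP)B_P+2a^{5/3}(L^I\omega)^\#\cdot B_\omega+a'a^{1/3}(Z^I\psi)B_\psi+a^{4/3}(\mathcal L_{\partial_t}G^{-1})(L^I\omega,L^I\omega),\\ \mathrm{Junk}={}&a'a^{1/3}\psi(Z^IP)^2+a'a^{5/3}\psi|L^I\omega|^2-2a^{5/3}(Z^IP)(L^I\omega)^\#\cdot\nabla\psi\\&+2a^{1/3}(Z^IP)J_P+2a^{5/3}(L^I\omega)^\#\cdot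 J_\omega+a'a^{5/3}(Z^I\psi)J_\psi .\end{aligned}$$ Moreover the three quadratic terms have a sign: $\frac43a'a^{1/3}|L^I\omega|^2\le0$, $a'a^3|\nabla Z^I\psi|^2\le0$ and $c\le0$. -/

import Mathlib

open Set

noncomputable section

namespace ScalarFieldCurrent

/-! ### The round three-sphere of radius three and its Lie-transported frame -/

/-- The ambient Euclidean space `ℝ⁴`. -/
abbrev E4 := EuclideanSpace ℝ (Fin 4)

/-- The sphere `{y ∈ ℝ⁴ | ∑ (yⁱ)² = 9}`; its induced round metric has scalar curvature `2/3`. -/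
abbrev S3 := Metric.sphere (0 : E4) 3

/-- Radial projection of `ℝ⁴ ∖ {0}` onto the sphere (with an irrelevant value at the origin). -/
def toS3 (y : E4) : S3 :=
  if h : y = 0 then
    ⟨EuclideanSpace.single 0 3, by simp⟩
  else
    ⟨(3 / ‖y‖) • y, by
      have hy : ‖y‖ ≠ 0 := norm_ne_zero_iff.mpr h
      rw [mem_sphere_zero_iff_norm, norm_smul, norm_div, norm_norm, Real.norm_eq_abs,
        abs_of_pos (by norm_num : (0 : ℝ) < 3), div_mul_cancel₀ _ hy]⟩

/-- Coordinate basis vector of `ℝ⁴`. -/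
def basisVec (k : Fin 4) : E4 := EuclideanSpace.single k 1

/-- The rotation vectorfield `(1/3) (yᵏ ∂ₗ - yˡ ∂ₖ)`. -/
def rot (k l : Fin 4) (y : E4) : E4 :=
  (1 / 3 : ℝ) • (y k • basisVec l - y l • basisVec k)

/-- The Killing frame `Z₁ = R₁₂ + R₃₄`, `Z₂ = R₂₃ + R₁₄`, `Z₃ = R₁₃ - R₂₄` (indices shifted
by one). The transported spatial frame does not depend on time. -/
def Zvec : Fin 3 → E4 → E4 :=
  ![fun y => rot 0 1 y + rot 2 3 y,
    fun y => rot 1 2 y + rot 0 3 y,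
    fun y => rot 0 2 y - rot 1 3 y]

/-- The fully antisymmetric symbol, with value `1` at `(0,1,2)`. -/
def eps (A B C : Fin 3) : ℝ :=
  (((B : ℕ) : ℝ) - ((A : ℕ) : ℝ)) * (((C : ℕ) : ℝ) - ((A : ℕ) : ℝ)) *
    (((C : ℕ) : ℝ) - ((B : ℕ) : ℝ)) / 2

/-- Structure constants of the frame: `[Z_A, Z_B] = ∑_C c_{AB}^C Z_C`
(this is `lieBracket_Zvec` below). -/
def structConst (A B C : Fin 3) : ℝ := (2 / 3) * eps A B C

theorem Zvec_zero (y : E4) :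
    Zvec 0 y = !₂[-(y 1 / 3), y 0 / 3, -(y 3 / 3), y 2 / 3] := by
  ext i; fin_cases i <;> simp [Zvec, rot, basisVec] <;> ring

theorem Zvec_one (y : E4) :
    Zvec 1 y = !₂[-(y 3 / 3), -(y 2 / 3), y 1 / 3, y 0 / 3] := by
  ext i; fin_cases i <;> simp [Zvec, rot, basisVec] <;> ring

theorem Zvec_two (y : E4) :
    Zvec 2 y = !₂[-(y 2 / 3), y 3 / 3, y 0 / 3, -(y 1 / 3)] := by
  ext i; fin_cases i <;> simp [Zvec, rot, basisVec] <;> ring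

/-- The frame vectorfields are linear. -/
theorem fderiv_Zvec (A : Fin 3) (y v : E4) : fderiv ℝ (Zvec A) y v = Zvec A v := by
  have hl : IsLinearMap ℝ (Zvec A) := by
    constructor
    · intro v w
      ext i
      fin_cases A <;> fin_cases i <;> simp [Zvec_zero, Zvec_one, Zvec_two] <;> ring
    · intro c v
      ext i
      fin_cases A <;> fin_cases i <;> simp [Zvec_zero, Zvec_one, Zvec_two] <;> ring
  have h := (LinearMap.toContinuousLinearMap (hl.mk' (Zvec A))).hasFDerivAt (x := y)
  have h' : HasFDerivAt (Zvec A) (LinearMap.toContinuousLinearMap (hl.mk' (Zvec A))) y := h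
  rw [h'.fderiv]
  rfl

/-- The commutation relations of the frame. -/
theorem lieBracket_Zvec (A B : Fin 3) (y : E4) :
    VectorField.lieBracket ℝ (Zvec A) (Zvec B) y = ∑ C, structConst A B C • Zvec C y := by
  rw [VectorField.lieBracket, fderiv_Zvec, fderiv_Zvec, Fin.sum_univ_three]
  ext i
  fin_cases A <;> fin_cases B <;> fin_cases i <;>
    simp [structConst, eps, Zvec_zero, Zvec_one, Zvec_two] <;> ring

/-- On the sphere of radius three the frame is orthonormal. -/
theorem inner_Zvec (A B : Fin 3) (y : S3) :
    inner ℝ (Zvec A y) (Zvec B y) = if A = B then 1 else 0 := by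
  have hy : ‖(y : E4)‖ = 3 := mem_sphere_zero_iff_norm.mp y.2
  have h2 : (y : E4) 0 ^ 2 + (y : E4) 1 ^ 2 + (y : E4) 2 ^ 2 + (y : E4) 3 ^ 2 = 9 := by
    have h := EuclideanSpace.real_norm_sq_eq (y : E4)
    rw [hy, Fin.sum_univ_four] at h
    linarith
  rw [PiLp.inner_apply, Fin.sum_univ_four]
  fin_cases A <;> fin_cases B <;>
    simp [Zvec_zero, Zvec_one, Zvec_two, div_pow] <;> linarith

/-- The frame is tangent to the spheres centred at the origin. -/
theorem inner_Zvec_self (A : Fin 3) (y : E4) : inner ℝ y (Zvec A y) = 0 := by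
  rw [PiLp.inner_apply, Fin.sum_univ_four]
  fin_cases A <;> simp [Zvec_zero, Zvec_one, Zvec_two] <;> ring

/-! ### Scalar functions and tensorfields on `[0,T) × S³`

`Σ_t`-tangent tensorfields are given by their components in the global frame `Z_A` and its dual
coframe `θ^A`. For two-index tensorfields the order of the indices is `ξ A B = ξ_{AB}`,
`ξ^{AB}` or `ξ^A_B`, according to the type. -/

/-- Functions of time and of the point of the sphere. -/
abbrev Scalar := ℝ → S3 → ℝ

/-- Components of a one-form or of a vectorfield. -/
abbrev Tensor1 := Fin 3 → Scalar

/-- Components of a tensorfield with two indices. -/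
abbrev Tensor2 := Fin 3 → Fin 3 → Scalar

/-- `f` is of class `C^m` on `[0,T) × S³`. -/
def IsCk (m : ℕ) (T : ℝ) (f : Scalar) : Prop :=
  ContDiffOn ℝ m (fun p : ℝ × E4 => f p.1 (toS3 p.2)) (Ico 0 T ×ˢ {(0 : E4)}ᶜ)

/-- The derivative of `f` along `Z_A`. -/
def dZ (A : Fin 3) (f : Scalar) : Scalar :=
  fun t x => fderiv ℝ (fun y : E4 => f t (toS3 y)) (x : E4) (Zvec A (x : E4))

/-- The time derivative on `[0,T)` (one-sided at `0`). Since the frame is Lie-transported, the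
projected Lie derivative along `∂_t` of a tensorfield acts by `dt` on every component. -/
def dt (T : ℝ) (f : Scalar) : Scalar :=
  fun t x => derivWithin (fun s => f s x) (Ico 0 T) t

/-- A function of time alone, seen as a function on `[0,T) × S³`. -/
def ofTime (h : ℝ → ℝ) : Scalar := fun t _ => h t

/-! ### Lie derivatives along the frame, from `L_{Z_C} Z_B = c_{CB}^D Z_D` and
`L_{Z_C} θ^A = - c_{CD}^A θ^D` -/

/-- Lie derivative of a one-form. -/
def lieForm (C : Fin 3) (ξ : Tensor1) : Tensor1 :=
  fun B => dZ C (ξ B) - ∑ D, structConst C B D • ξ D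

/-- Lie derivative of a type `(2,0)` tensorfield. -/
def lieCon (C : Fin 3) (ξ : Tensor2) : Tensor2 :=
  fun A B => dZ C (ξ A B) + ∑ D, structConst C D A • ξ D B + ∑ D, structConst C D B • ξ A D

/-- Lie derivative of a type `(1,1)` tensorfield. -/
def lieMix (C : Fin 3) (ξ : Tensor2) : Tensor2 :=
  fun A B => dZ C (ξ A B) + ∑ D, structConst C D A • ξ D B - ∑ D, structConst C B D • ξ A D

/-- `opI op (i₁, …, i_N) ξ = op i₁ (op i₂ (⋯ (op i_N ξ)))`. -/
def opI {α : Type} (op : Fin 3 → α → α) (I : List (Fin 3)) (ξ : α) : α := I.foldr op ξ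

/-- The ordered pairs `(I₁, I₂)` with `I₁ + I₂ = I`, as in the Leibniz rule: `I₁` is the
subfamily of the entries of `I` at some set of positions and `I₂` is the complementary
subfamily, both in the order of `I`, and either may be empty. -/
def splits2 : List (Fin 3) → List (List (Fin 3) × List (Fin 3))
  | [] => [([], [])]
  | i :: I => (splits2 I).flatMap fun p => [(i :: p.1, p.2), (p.1, i :: p.2)]

/-- The ordered triples `(I₁, I₂, I₃)` with `I₁ + I₂ + I₃ = I`, as in the Leibniz rule. -/
def splits3 (I : List (Fin 3)) : List (List (Fin 3) × List (Fin 3) × List (Fin 3)) :=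
  (splits2 I).flatMap fun p => (splits2 p.2).map fun q => (p.1, q.1, q.2)

/-! ### Levi-Civita connections relative to a frame -/

section Frame

variable {ι : Type} [Fintype ι] [DecidableEq ι]

/-- The inverse of the matrix of components of a metric. -/
def invMetric (g : ι → ι → Scalar) (A B : ι) : Scalar :=
  fun t x => (Matrix.of fun C D => g C D t x)⁻¹ A B

/-- Connection coefficients `∇_{e_A} e_B = ∑_D Γ_A^D_B e_D` of the Levi-Civita connection of `g`
relative to a frame `e` with derivations `d` and structure constants `[e_A,e_B] = c_{AB}^C e_C`,
by Koszul's formula. -/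
def christoffel (d : ι → Scalar → Scalar) (c : ι → ι → ι → ℝ) (g : ι → ι → Scalar)
    (A D B : ι) : Scalar :=
  ∑ C, invMetric g C D * ((1 / 2 : ℝ) •
    (d A (g B C) + d B (g A C) - d C (g A B)
      + ∑ E, (c A B E • g E C - c A C E • g E B - c B C E • g E A)))

/-- Covariant divergence of the vectorfield `J = ∑ J^A e_A`. -/
def divVec (d : ι → Scalar → Scalar) (c : ι → ι → ι → ℝ) (g : ι → ι → Scalar)
    (J : ι → Scalar) : Scalar :=
  ∑ A, (d A (J A) + ∑ B, christoffel d c g A A B * J B)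

end Frame

/-! ### Geometry of the spatial metric `G` -/

/-- Connection coefficients of `G`: `∇_{Z_A} Z_B = ∑_D Γ_A^D_B Z_D`. -/
def Gam (G : Tensor2) (A D B : Fin 3) : Scalar := christoffel dZ structConst G A D B

/-- Divergence of a spatial vectorfield. -/
def divG (G : Tensor2) (X : Tensor1) : Scalar := divVec dZ structConst G X

/-- Raising the index of a one-form with `G⁻¹`. -/
def sharp (G : Tensor2) (ξ : Tensor1) : Tensor1 := fun A => ∑ B, invMetric G A B * ξ B

/-- The natural contraction of a one-form and a vectorfield. -/
def contract (ξ X : Tensor1) : Scalar := ∑ A, ξ A * X A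

/-- `|ξ|²` for a one-form. -/
def normSqForm (G : Tensor2) (ξ : Tensor1) : Scalar :=
  ∑ A, ∑ B, invMetric G A B * ξ A * ξ B

/-- `|ξ|²` for a type `(1,1)` tensorfield. -/
def normSqMix (G : Tensor2) (ξ : Tensor2) : Scalar :=
  ∑ A, ∑ A', ∑ B, ∑ B', G A A' * invMetric G B B' * ξ A B * ξ A' B'

/-- The differential of a function. -/
def grad (f : Scalar) : Tensor1 := fun A => dZ A f

/-- `(∇_{Z_A} ξ)_B` for a one-form. -/
def covForm (G : Tensor2) (ξ : Tensor1) (A B : Fin 3) : Scalar :=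
  dZ A (ξ B) - ∑ D, Gam G A D B * ξ D

/-- `(∇_{Z_A} ξ)^C_B` for a type `(1,1)` tensorfield. -/
def covMix (G : Tensor2) (ξ : Tensor2) (A C B : Fin 3) : Scalar :=
  dZ A (ξ C B) + ∑ D, Gam G A C D * ξ D B - ∑ D, Gam G A D B * ξ C D

/-- Divergence `(G⁻¹)^{AB} ∇_A ξ_B` of a one-form. -/
def divForm (G : Tensor2) (ξ : Tensor1) : Scalar :=
  ∑ A, ∑ B, invMetric G A B * covForm G ξ A B

/-- The Laplacian of a function. -/
def lap (G : Tensor2) (f : Scalar) : Scalar := divForm G (grad f)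

/-- `(∇^# ∇ f)^A_B`. -/
def hessSharp (G : Tensor2) (f : Scalar) : Tensor2 :=
  fun A B => ∑ C, invMetric G A C * covForm G (grad f) C B

/-- Divergence `(div ξ)_B = ∇_A ξ^A_B` of a type `(1,1)` tensorfield. -/
def divMix (G : Tensor2) (ξ : Tensor2) : Tensor1 := fun B => ∑ A, covMix G ξ A A B

/-- Divergence `(div^# ξ)^C = (G⁻¹)^{AB} ∇_A ξ^C_B` of a type `(1,1)` tensorfield. -/
def divSharpMix (G : Tensor2) (ξ : Tensor2) : Tensor1 :=
  fun C => ∑ A, ∑ B, invMetric G A B * covMix G ξ A C B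

/-- The curvature components `R(Z_A,Z_B) Z_C = ∑_D R_{AB}^D_C Z_D`, where
`R(X,Y) = ∇_X ∇_Y - ∇_Y ∇_X - ∇_{[X,Y]}`. -/
def curv (G : Tensor2) (A B D C : Fin 3) : Scalar :=
  dZ A (Gam G B D C) - dZ B (Gam G A D C)
    + ∑ E, (Gam G B E C * Gam G A D E - Gam G A E C * Gam G B D E
      - structConst A B E • Gam G E D C)

/-- Ricci curvature, positive for round spheres. -/
def ricci (G : Tensor2) : Tensor2 := fun B C => ∑ A, curv G A B A C

/-- `(Ric^#)^A_B`. -/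
def ricciSharp (G : Tensor2) : Tensor2 := fun A B => ∑ C, invMetric G A C * ricci G C B

/-- Scalar curvature. -/
def scalarCurv (G : Tensor2) : Scalar := ∑ A, ricciSharp G A A

/-- The identity transformation. -/
def idT : Tensor2 := fun A B => if A = B then 1 else 0

/-! ### The auxiliary spacetime metric `-dt² + G` -/

/-- Index set of the spacetime frame `∂_t, Z_1, Z_2, Z_3`. -/
abbrev STIndex := Unit ⊕ Fin 3

/-- Derivatives along the spacetime frame. -/
def dST (T : ℝ) : STIndex → Scalar → Scalar
  | .inl _ => dt T
  | .inr A => dZ A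

/-- Structure constants of the spacetime frame; `[∂_t, Z_A] = 0`. -/
def structConstST : STIndex → STIndex → STIndex → ℝ
  | .inr A, .inr B, .inr C => structConst A B C
  | _, _, _ => 0

/-- The Lorentzian metric `-dt² + G`. -/
def auxMetric (G : Tensor2) : STIndex → STIndex → Scalar
  | .inl _, .inl _ => -1
  | .inr A, .inr B => G A B
  | _, _ => 0

/-- Covariant divergence of a spacetime vectorfield with respect to `-dt² + G`. -/
def divST (T : ℝ) (G : Tensor2) (J : STIndex → Scalar) : Scalar :=
  divVec (dST T) structConstST (auxMetric G) J

/-! ### The scale factor -/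

/-- `a` is the FLRW scale factor on `[0,T)`: the positive solution of `a'' = -(2/3) a^{1/3}` with
`a(0) = 1`, `a'(0) = 0`. -/
structure IsScaleFactor (a : ℝ → ℝ) (T : ℝ) : Prop where
  pos : ∀ t ∈ Ico 0 T, 0 < a t
  contDiff : ContDiffOn ℝ 2 a (Ico 0 T)
  init : a 0 = 1
  init_deriv : derivWithin a (Ico 0 T) 0 = 0
  ode : ∀ t ∈ Ico 0 T,
    derivWithin (derivWithin a (Ico 0 T)) (Ico 0 T) t = -(2 / 3) * a t ^ (1 / 3 : ℝ)

/-- The power `a^p`. -/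
def apow (a : ℝ → ℝ) (p : ℝ) : Scalar := ofTime fun t => a t ^ p

/-- The derivative `a'`. -/
def aprime (a : ℝ → ℝ) (T : ℝ) : Scalar := ofTime (derivWithin a (Ico 0 T))

/-! ### The rescaled Einstein-scalar field equations -/

/-- The time-rescaled variables. With `g` the spatial metric, `k̂` the trace-free part of the
(mixed) second fundamental form, `n` the lapse and `φ` the scalar field, these are
`G = a^{-2/3} g`, `K = a k̂` of type `(1,1)`, `lapse = a^{-4/3} (n - 1)`,
`timeSf = n⁻¹ a ∂_t φ - √(2/3)` and `spaceSf = ∇φ`. -/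
structure Fields where
  G : Tensor2
  K : Tensor2
  lapse : Scalar
  timeSf : Scalar
  spaceSf : Tensor1

/-- The constant `√(2/3)`. -/
def κ : ℝ := Real.sqrt (2 / 3)

/-- `n = 1 + a^{4/3} · lapse`. -/
def fullLapse (a : ℝ → ℝ) (u : Fields) : Scalar := 1 + apow a (4 / 3) * u.lapse

/-- The zeroth order coefficient of the first elliptic lapse operator. -/
def ellF (a : ℝ → ℝ) (T : ℝ) (u : Fields) : Scalar :=
  aprime a T ^ 2 + (2 / 3 : ℝ) • apow a (4 / 3) + normSqMix u.G u.K
    + (2 * κ) • u.timeSf + u.timeSf ^ 2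

/-- The elliptic operator `a^{8/3} Δ - a^{4/3} f`. -/
def ellL (a : ℝ → ℝ) (T : ℝ) (u : Fields) (h : Scalar) : Scalar :=
  apow a (8 / 3) * lap u.G h - apow a (4 / 3) * ellF a T u * h

/-- The zeroth order coefficient of the second elliptic lapse operator. -/
def ellFLow (a : ℝ → ℝ) (T : ℝ) (u : Fields) : Scalar :=
  aprime a T ^ 2 + (2 / 3 : ℝ) • apow a (4 / 3)
    + apow a (4 / 3) * (scalarCurv u.G - (2 / 3 : ℝ) • (1 : Scalar))
    - apow a (4 / 3) * normSqForm u.G u.spaceSf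

/-- The elliptic operator `a^{4/3} Δ - f̃`. -/
def ellLLow (a : ℝ → ℝ) (T : ℝ) (u : Fields) (h : Scalar) : Scalar :=
  apow a (4 / 3) * lap u.G h - ellFLow a T u * h

/-- `u` is a solution of class `C^m` on `[0,T) × S³` of the Einstein-scalar field equations, in
CMC-transported spatial coordinates gauge, in terms of the time-rescaled variables. -/
structure IsSolution (a : ℝ → ℝ) (T : ℝ) (m : ℕ) (u : Fields) : Prop where
  reg_G : ∀ A B, IsCk m T (u.G A B)
  reg_K : ∀ A B, IsCk m T (u.K A B)
  reg_lapse : IsCk m T u.lapse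
  reg_timeSf : IsCk m T u.timeSf
  reg_spaceSf : ∀ A, IsCk m T (u.spaceSf A)
  /-- `G` is a Riemannian metric. -/
  posDef : ∀ t ∈ Ico 0 T, ∀ x, (Matrix.of fun A B => u.G A B t x).PosDef
  /-- `K` is trace-free. -/
  traceFree : ∀ t ∈ Ico 0 T, ∀ x, (∑ A, u.K A A) t x = 0
  /-- `K` with its upper index lowered is symmetric. -/
  symm : ∀ t ∈ Ico 0 T, ∀ x, ∀ A B,
    (∑ C, u.G A C * u.K C B) t x = (∑ C, u.G B C * u.K C A) t x
  /-- Hamiltonian constraint. -/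
  hamiltonian : ∀ t ∈ Ico 0 T, ∀ x,
    (apow a (4 / 3) * (scalarCurv u.G - (2 / 3 : ℝ) • (1 : Scalar)) - normSqMix u.G u.K) t x
      = ((2 * κ) • u.timeSf + u.timeSf ^ 2 + apow a (4 / 3) * normSqForm u.G u.spaceSf) t x
  /-- Momentum constraint. -/
  momentum : ∀ t ∈ Ico 0 T, ∀ x, ∀ B,
    divMix u.G u.K B t x = (-(κ • u.spaceSf B) - u.timeSf * u.spaceSf B) t x
  /-- Momentum constraint, alternate form. -/
  momentum' : ∀ t ∈ Ico 0 T, ∀ x, ∀ B,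
    divSharpMix u.G u.K B t x
      = (-(κ • sharp u.G u.spaceSf B) - u.timeSf * sharp u.G u.spaceSf B) t x
  /-- Evolution of the metric. -/
  evol_G : ∀ t ∈ Ico 0 T, ∀ x, ∀ A B,
    dt T (u.G A B) t x
      = (-(2 * apow a (-1) * ∑ C, u.G A C * u.K C B)
          - 2 * apow a (1 / 3) * u.lapse * ∑ C, u.G A C * u.K C B
          + (2 / 3 : ℝ) • (apow a (1 / 3) * aprime a T * u.lapse * u.G A B)) t x
  /-- Evolution of the inverse metric. -/
  evol_Ginv : ∀ t ∈ Ico 0 T, ∀ x, ∀ A B,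
    dt T (invMetric u.G A B) t x
      = (2 * apow a (-1) * ∑ C, invMetric u.G A C * u.K B C
          + 2 * apow a (1 / 3) * u.lapse * ∑ C, invMetric u.G A C * u.K B C
          - (2 / 3 : ℝ) • (apow a (1 / 3) * aprime a T * u.lapse * invMetric u.G A B)) t x
  /-- Evolution of the second fundamental form. -/
  evol_K : ∀ t ∈ Ico 0 T, ∀ x, ∀ A B,
    dt T (u.K A B) t x
      = (-(apow a (5 / 3) * hessSharp u.G u.lapse A B)
          + apow a (1 / 3) * fullLapse a u * (ricciSharp u.G A B - (2 / 9 : ℝ) • idT A B)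
          + (1 / 3 : ℝ) • (aprime a T ^ 2 * apow a (1 / 3) * u.lapse * idT A B)
          + (2 / 9 : ℝ) • (apow a (5 / 3) * u.lapse * idT A B)
          - apow a (1 / 3) * aprime a T * u.lapse * u.K A B
          - apow a (1 / 3) * (sharp u.G u.spaceSf A * u.spaceSf B)
          - apow a (5 / 3) * u.lapse * (sharp u.G u.spaceSf A * u.spaceSf B)) t x
  /-- Scalar field wave equation. -/
  evol_timeSf : ∀ t ∈ Ico 0 T, ∀ x,
    dt T u.timeSf t x
      = (fullLapse a u * apow a (1 / 3) * divForm u.G u.spaceSf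
          - κ • (aprime a T * apow a (1 / 3) * u.lapse)
          - apow a (1 / 3) * aprime a T * u.lapse * u.timeSf
          + apow a (5 / 3) * contract u.spaceSf (sharp u.G (grad u.lapse))) t x
  /-- Evolution of the spatial derivatives of the scalar field. -/
  evol_spaceSf : ∀ t ∈ Ico 0 T, ∀ x, ∀ A,
    dt T (u.spaceSf A) t x
      = (apow a (-1) * fullLapse a u * grad u.timeSf A
          + κ • (apow a (1 / 3) * grad u.lapse A)
          + apow a (1 / 3) * u.timeSf * grad u.lapse A) t x
  /-- Elliptic lapse equation. -/
  ell : ∀ t ∈ Ico 0 T, ∀ x,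
    ellL a T u u.lapse t x = ((2 * κ) • u.timeSf + normSqMix u.G u.K + u.timeSf ^ 2) t x
  /-- Elliptic lapse equation, second form. -/
  ell_low : ∀ t ∈ Ico 0 T, ∀ x,
    ellLLow a T u u.lapse t x
      = (scalarCurv u.G - (2 / 3 : ℝ) • (1 : Scalar) - normSqForm u.G u.spaceSf) t x

/-! ### Inhomogeneous terms of the commuted equations -/

/-- `Z^I f`. -/
abbrev zI (I : List (Fin 3)) (f : Scalar) : Scalar := opI dZ I f

/-- `L_Z^I ξ` for a one-form. -/
abbrev lieFormI (I : List (Fin 3)) (ξ : Tensor1) : Tensor1 := opI lieForm I ξ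

/-- `L_Z^I ξ` for a type `(2,0)` tensorfield. -/
abbrev lieConI (I : List (Fin 3)) (ξ : Tensor2) : Tensor2 := opI lieCon I ξ

/-- `L_Z^I ξ` for a type `(1,1)` tensorfield. -/
abbrev lieMixI (I : List (Fin 3)) (ξ : Tensor2) : Tensor2 := opI lieMix I ξ

section Inhom

variable (a : ℝ → ℝ) (T : ℝ) (u : Fields) (I : List (Fin 3))

/-- Borderline term of the commuted wave equation. -/
def timeSfBorder : Scalar := -(aprime a T * zI I u.lapse * u.timeSf)

/-- Junk term of the commuted wave equation: the sum over `|I₁| ≤ |I| - 1`, the commutators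
`[L_Z^I, div]` and `[L_Z^I, lapse · div]` applied to `spaceSf`, and the derivative of
`a^{4/3} ∇^# lapse · spaceSf`. -/
def timeSfJunk : Scalar :=
  -(aprime a T * (((splits2 I).filter fun p => p.1.length < I.length).map fun p =>
      zI p.1 u.lapse * zI p.2 u.timeSf).sum)
    + (zI I (divForm u.G u.spaceSf) - divForm u.G (lieFormI I u.spaceSf))
    + apow a (4 / 3) * (zI I (u.lapse * divForm u.G u.spaceSf)
        - u.lapse * divForm u.G (lieFormI I u.spaceSf))
    + apow a (4 / 3) * ((splits3 I).map fun p =>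
        ∑ A, ∑ B, grad (zI p.1 u.lapse) A * lieConI p.2.1 (invMetric u.G) A B
          * lieFormI p.2.2 u.spaceSf B).sum

/-- Borderline term of the commuted evolution equation for `spaceSf`. -/
def spaceSfBorder : Tensor1 := fun B => u.timeSf * grad (zI I u.lapse) B

/-- Junk term of the commuted evolution equation for `spaceSf`:
`[L_Z^I, lapse] ∇ timeSf + [L_Z^I, timeSf] ∇ lapse`. -/
def spaceSfJunk : Tensor1 := fun B =>
  (lieFormI I (fun C => u.lapse * grad u.timeSf C) B - u.lapse * lieFormI I (grad u.timeSf) B)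
    + (lieFormI I (fun C => u.timeSf * grad u.lapse C) B
        - u.timeSf * lieFormI I (grad u.lapse) B)

/-- Borderline term of the commuted elliptic lapse equation. -/
def lapseHighBorder : Scalar :=
  ((splits2 I).map fun p => ∑ A, ∑ B, lieMixI p.1 u.K A B * lieMixI p.2 u.K B A).sum
    + ((splits2 I).map fun p => zI p.1 u.timeSf * zI p.2 u.timeSf).sum

/-- The commutator `[Z^I, h]` of `Z^I` with multiplication by `h`, applied to `f`. -/
def commMul (h f : Scalar) : Scalar := zI I (h * f) - h * zI I f

/-- Junk term of the commuted elliptic lapse equation. -/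
def lapseHighJunk : Scalar :=
  apow a (4 / 3) * (lap u.G (zI I u.lapse) - zI I (lap u.G u.lapse))
    + commMul I (normSqMix u.G u.K) u.lapse
    + (2 * κ) • commMul I u.timeSf u.lapse
    + commMul I (u.timeSf ^ 2) u.lapse

/-! ### The scalar field energy current and its error terms -/

/-- The scalar field energy current associated to a scalar function `P` and a one-form `ω`:
`J⁰ = P² + a^{4/3} |ω|²`, `J = -2 (1 + a^{4/3} lapse) a^{1/3} P ω^#`. -/
def sfCurrent (P : Scalar) (ω : Tensor1) : STIndex → Scalar
  | .inl _ => P ^ 2 + apow a (4 / 3) * normSqForm u.G ω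
  | .inr A => -(2 * fullLapse a u * apow a (1 / 3) * P * sharp u.G ω A)

/-- Borderline error term of the divergence identity. -/
def sfCurrentBorder : Scalar :=
  2 * apow a (1 / 3) * zI I u.timeSf * timeSfBorder a T u I
    + 2 * apow a (5 / 3) * contract (spaceSfBorder u I) (sharp u.G (lieFormI I u.spaceSf))
    + aprime a T * apow a (1 / 3) * zI I u.lapse * lapseHighBorder u I
    + apow a (4 / 3) * ∑ A, ∑ B, dt T (invMetric u.G A B)
        * lieFormI I u.spaceSf A * lieFormI I u.spaceSf B

/-- Junk error term of the divergence identity. -/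
def sfCurrentJunk : Scalar :=
  aprime a T * apow a (1 / 3) * u.lapse * zI I u.timeSf ^ 2
    + aprime a T * apow a (5 / 3) * u.lapse * normSqForm u.G (lieFormI I u.spaceSf)
    - 2 * apow a (5 / 3) * zI I u.timeSf
        * contract (grad u.lapse) (sharp u.G (lieFormI I u.spaceSf))
    + 2 * apow a (1 / 3) * zI I u.timeSf * timeSfJunk a T u I
    + 2 * apow a (5 / 3) * contract (spaceSfJunk u I) (sharp u.G (lieFormI I u.spaceSf))
    + aprime a T * apow a (5 / 3) * zI I u.lapse * lapseHighJunk a u I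

/-- The coefficient of `|Z^I lapse|²` in the divergence identity. -/
def lapseCoeff : Scalar :=
  aprime a T ^ 3 * apow a (5 / 3) + (2 / 3 : ℝ) • (aprime a T * apow a 3)
    + aprime a T * apow a (5 / 3) * normSqMix u.G u.K
    + (2 * κ) • (aprime a T * apow a (5 / 3) * u.timeSf)
    + aprime a T * apow a (5 / 3) * u.timeSf ^ 2

end Inhom

end ScalarFieldCurrent

end

open ScalarFieldCurrent

noncomputable section

namespace ScalarFieldCurrent

/-! ### Differential calculus on `[0,T) × S³` -/

/-! Write ψ, P, ω for the commuted unknowns and n = 1 + a^{4/3}·lapse. For the metric `-dt² + G` the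
divergence of the current is ∂_t J⁰ + ½ tr(G⁻¹ ∂_t G) J⁰ + div J. Since K is trace-free, the half
trace is a^{1/3} a'·lapse, which only yields junk.

In ∂_t J⁰ the commuted evolution equations produce 2 a^{1/3} n P div ω and 2 a^{1/3} n ∇P·ω^#; the
spatial flux J is chosen so that div J cancels both. Differentiating the weight a^{4/3} gives the
signed term (4/3) a' a^{1/3} |ω|².

One indefinite product then survives, -2κ a' a^{1/3} ψ P. The elliptic lapse equation, multiplied by
a' a^{1/3} ψ, expresses a' a³ ψ Δψ as a' a^{5/3} f ψ² + 2κ a' a^{1/3} ψ P + errors. Adding a' a³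
div(ψ ∇^#ψ) = a' a³ (|∇ψ|² + ψ Δψ) therefore removes the product and leaves quadratic lapse terms
with coefficients a' a³ and c = a' a^{5/3} f. The signs follow from a' ≤ 0 and from f = (a')²/3 +
|K|² + (P + κ)² ≥ 0 (uncommuted P), a consequence of the Friedmann equation and κ² = 2/3.

The rest is commutation. `opI_map₂` is a Leibniz rule for any bilinear pairing compatible with the
operators, `lieFormI_grad` says that Lie derivatives commute with the differential, and `dt_zI`,
`dt_lieFormI` exchange time and frame derivatives. These give `dt_zI_timeSf`, `dt_lieFormI_spaceSf`
and `lap_zI_lapse`. The geometric inputs are `divST_eq` and `divG_sharp`; `divST_sfCurrent` combines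
them.

Solutions are controlled only for t in [0,T), so identities between functions are mostly stated
after evaluation at a fixed t. -/

/-- `f` is of class `C^k` on the sphere at the fixed time `t`. -/
def Sm (k : ℕ) (t : ℝ) (f : Scalar) : Prop :=
  ContDiffOn ℝ k (fun y : E4 => f t (toS3 y)) {(0 : E4)}ᶜ

/-- The degree zero homogeneous extension of `f` in the space variable. -/
def ext0 (f : Scalar) : ℝ × E4 → ℝ := fun p => f p.1 (toS3 p.2)

/-- The domain `[0,T) × (ℝ⁴ ∖ {0})`. -/
def domST (T : ℝ) : Set (ℝ × E4) := Ico 0 T ×ˢ {(0 : E4)}ᶜ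

/-! ### Radial extension from the sphere to ℝ⁴ ∖ {0} -/

theorem coe_ne_zero (x : S3) : (x : E4) ≠ 0 := by
  intro h
  have := mem_sphere_zero_iff_norm.mp x.2
  rw [h] at this
  norm_num at this

theorem toS3_coe (x : S3) : toS3 x = x := by
  have hx : ‖(x : E4)‖ = 3 := mem_sphere_zero_iff_norm.mp x.2
  apply Subtype.ext
  rw [toS3, dif_neg (coe_ne_zero x)]
  simp [hx]

theorem toS3_smul {c : ℝ} (hc : 0 < c) (y : E4) : toS3 (c • y) = toS3 y := by
  by_cases hy : y = 0
  · simp [hy]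
  · have hcy : c • y ≠ 0 := smul_ne_zero hc.ne' hy
    apply Subtype.ext
    rw [toS3, toS3, dif_neg hy, dif_neg hcy]
    have hn : ‖y‖ ≠ 0 := norm_ne_zero_iff.mpr hy
    simp only [norm_smul, Real.norm_eq_abs, abs_of_pos hc, smul_smul]
    congr 1
    field_simp

theorem coe_toS3 {y : E4} (hy : y ≠ 0) : (toS3 y : E4) = (3 / ‖y‖) • y := by
  rw [toS3, dif_neg hy]

/-- The frame as linear vectorfields. -/
def ZvecL (A : Fin 3) : E4 →L[ℝ] E4 := fderiv ℝ (Zvec A) 0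

theorem ZvecL_apply (A : Fin 3) (y : E4) : ZvecL A y = Zvec A y := fderiv_Zvec A 0 y

theorem isOpen_compl_zero : IsOpen ({(0 : E4)}ᶜ : Set E4) := isOpen_compl_singleton

theorem uniqueDiffOn_domST (T : ℝ) : UniqueDiffOn ℝ (domST T) :=
  (uniqueDiffOn_Ico 0 T).prod isOpen_compl_zero.uniqueDiffOn

/-- The extension is constant along rays, so its differential is homogeneous of degree -1, while the
frame is linear: the pairing has degree 0. Hence the extension of a frame derivative is again a
directional derivative on all of ℝ⁴ ∖ {0}, which allows frame derivatives to be iterated. -/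
theorem dZ_toS3 (A : Fin 3) (f : Scalar) (t : ℝ) {y : E4} (hy : y ≠ 0) :
    dZ A f t (toS3 y) = fderiv ℝ (fun y : E4 => f t (toS3 y)) y (Zvec A y) := by
  have hc : 0 < 3 / ‖y‖ := div_pos (by norm_num) (norm_pos_iff.mpr hy)
  have h := fderiv_comp_smul (𝕜 := ℝ) (f := fun y : E4 => f t (toS3 y)) (x := y) (3 / ‖y‖)
  simp only [toS3_smul hc] at h
  rw [dZ, coe_toS3 hy, h, ← ZvecL_apply, ← ZvecL_apply, map_smul, map_smul]
  rfl

section Regularity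

variable {m k l : ℕ} {T t : ℝ} {f g : Scalar} {x : S3}

theorem IsCk.sm (hf : IsCk k T f) (ht : t ∈ Ico 0 T) : Sm k t f := by
  have h : MapsTo (fun y : E4 => (t, y)) {(0 : E4)}ᶜ (domST T) := fun y hy => ⟨ht, hy⟩
  exact ContDiffOn.comp (t := domST T) hf (by fun_prop) h

theorem IsCk.mono (hf : IsCk k T f) (h : l ≤ k) : IsCk l T f :=
  ContDiffOn.of_le hf (by exact_mod_cast h)

theorem Sm.mono (hf : Sm k t f) (h : l ≤ k) : Sm l t f :=
  ContDiffOn.of_le hf (by exact_mod_cast h)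

theorem Sm.congr (hf : Sm k t f) (h : g t = f t) : Sm k t g := by
  unfold Sm; rw [h]; exact hf

theorem Sm.zero : Sm k t 0 := contDiffOn_const
theorem IsCk.zero : IsCk k T 0 := contDiffOn_const
theorem IsCk.add (hf : IsCk k T f) (hg : IsCk k T g) : IsCk k T (f + g) := ContDiffOn.add hf hg
theorem Sm.add (hf : Sm k t f) (hg : Sm k t g) : Sm k t (f + g) := ContDiffOn.add hf hg
theorem IsCk.sub (hf : IsCk k T f) (hg : IsCk k T g) : IsCk k T (f - g) := ContDiffOn.sub hf hg
theorem Sm.sub (hf : Sm k t f) (hg : Sm k t g) : Sm k t (f - g) := ContDiffOn.sub hf hg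
theorem IsCk.neg (hf : IsCk k T f) : IsCk k T (-f) := ContDiffOn.neg hf
theorem IsCk.mul (hf : IsCk k T f) (hg : IsCk k T g) : IsCk k T (f * g) := ContDiffOn.mul hf hg
theorem Sm.mul (hf : Sm k t f) (hg : Sm k t g) : Sm k t (f * g) := ContDiffOn.mul hf hg
theorem Sm.pow (hf : Sm k t f) (n : ℕ) : Sm k t (f ^ n) := ContDiffOn.pow hf n
theorem IsCk.smul (c : ℝ) (hf : IsCk k T f) : IsCk k T (c • f) := ContDiffOn.const_smul c hf
theorem Sm.smul (c : ℝ) (hf : Sm k t f) : Sm k t (c • f) := ContDiffOn.const_smul c hf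

theorem IsCk.sum {ι : Type*} {s : Finset ι} {F : ι → Scalar} (h : ∀ i ∈ s, IsCk k T (F i)) :
    IsCk k T (∑ i ∈ s, F i) := by
  classical
  induction s using Finset.induction_on with
  | empty => simpa using IsCk.zero
  | insert i s hi ih =>
    rw [Finset.sum_insert hi]
    exact (h i (Finset.mem_insert_self _ _)).add
      (ih fun j hj => h j (Finset.mem_insert_of_mem hj))

theorem Sm.sum {ι : Type*} {s : Finset ι} {F : ι → Scalar} (h : ∀ i ∈ s, Sm k t (F i)) :
    Sm k t (∑ i ∈ s, F i) := by
  classical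
  induction s using Finset.induction_on with
  | empty => simpa using Sm.zero
  | insert i s hi ih =>
    rw [Finset.sum_insert hi]
    exact (h i (Finset.mem_insert_self _ _)).add
      (ih fun j hj => h j (Finset.mem_insert_of_mem hj))

theorem Sm.differentiableAt (hf : Sm k t f) (hk : 1 ≤ k) {y : E4} (hy : y ≠ 0) :
    DifferentiableAt ℝ (fun y : E4 => f t (toS3 y)) y :=
  (ContDiffOn.contDiffAt hf (isOpen_compl_zero.mem_nhds hy)).differentiableAt
    (by exact_mod_cast (by omega : k ≠ 0))

theorem Sm.dZ (hf : Sm (k + 1) t f) (A : Fin 3) : Sm k t (dZ A f) := by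
  have h : ContDiffOn ℝ k (fderiv ℝ (fun y : E4 => f t (toS3 y))) {(0 : E4)}ᶜ :=
    ContDiffOn.fderiv_of_isOpen hf isOpen_compl_zero (by norm_cast)
  refine (h.clm_apply (ZvecL A).contDiff.contDiffOn).congr fun y hy => ?_
  rw [dZ_toS3 A f t hy, ZvecL_apply]

/-! Algebraic rules for the spatial derivatives. -/

theorem dZ_congr (A : Fin 3) (h : f t = g t) : dZ A f t = dZ A g t := by
  unfold dZ; rw [h]

theorem dZ_const (A : Fin 3) (c : ℝ) : dZ A (fun _ _ => c) = 0 := by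
  funext t x; simp [dZ]

theorem dZ_zero (A : Fin 3) : dZ A 0 = 0 := dZ_const A 0

theorem dZ_add (hf : Sm 1 t f) (hg : Sm 1 t g) (A : Fin 3) :
    dZ A (f + g) t = dZ A f t + dZ A g t := by
  funext x
  have h := fderiv_add (hf.differentiableAt le_rfl (coe_ne_zero x))
    (hg.differentiableAt le_rfl (coe_ne_zero x))
  change fderiv ℝ ((fun y : E4 => f t (toS3 y)) + fun y : E4 => g t (toS3 y)) (x : E4) _ = _
  rw [h]; rfl

theorem dZ_smul (A : Fin 3) (c : ℝ) (f : Scalar) : dZ A (c • f) = c • dZ A f := by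
  funext t x
  have h := congrFun (fderiv_const_smul_field (𝕜 := ℝ) c
    (f := fun y : E4 => f t (toS3 y))) (x : E4)
  change fderiv ℝ (c • fun y : E4 => f t (toS3 y)) (x : E4) _ = _
  rw [h]; rfl

theorem dZ_mul (hf : Sm 1 t f) (hg : Sm 1 t g) (A : Fin 3) :
    dZ A (f * g) t = dZ A f t * g t + f t * dZ A g t := by
  funext x
  have h := fderiv_mul (hf.differentiableAt le_rfl (coe_ne_zero x))
    (hg.differentiableAt le_rfl (coe_ne_zero x))
  change fderiv ℝ ((fun y : E4 => f t (toS3 y)) * fun y : E4 => g t (toS3 y)) (x : E4) _ = _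
  rw [h]
  simp [dZ, toS3_coe]
  ring

theorem dZ_sum {ι : Type*} {s : Finset ι} {F : ι → Scalar} (h : ∀ i ∈ s, Sm 1 t (F i))
    (A : Fin 3) : dZ A (∑ i ∈ s, F i) t = ∑ i ∈ s, dZ A (F i) t := by
  classical
  induction s using Finset.induction_on with
  | empty => simp [dZ_zero]
  | insert i s hi ih =>
    rw [Finset.sum_insert hi, Finset.sum_insert hi,
      dZ_add (h i (Finset.mem_insert_self _ _))
        (Sm.sum fun j hj => h j (Finset.mem_insert_of_mem hj)),
      ih fun j hj => h j (Finset.mem_insert_of_mem hj)]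

/-- Z_A Z_B f splits into a Hessian term, symmetric in A and B, and a first order term in which Z_B
is differentiated along Z_A; antisymmetrizing the latter gives the Lie bracket. -/
theorem dZ_comm (hf : Sm 2 t f) (A B : Fin 3) :
    dZ A (dZ B f) t = dZ B (dZ A f) t + ∑ C, structConst A B C • dZ C f t := by
  funext x
  set φ : E4 → ℝ := fun y => f t (toS3 y) with hφ
  have hx := (coe_ne_zero x)
  have hφ2 : ContDiffAt ℝ 2 φ x := ContDiffOn.contDiffAt hf (isOpen_compl_zero.mem_nhds hx)
  have hd : DifferentiableAt ℝ (fderiv ℝ φ) x :=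
    (hφ2.fderiv_right (m := 1) (by norm_num)).differentiableAt (by norm_num)
  have key : ∀ A B : Fin 3, dZ A (dZ B f) t x =
      fderiv ℝ (fderiv ℝ φ) x (Zvec A x) (Zvec B x) + fderiv ℝ φ x (Zvec B (Zvec A x)) := by
    intro A B
    have he : (fun y : E4 => dZ B f t (toS3 y)) =ᶠ[nhds (x : E4)]
        fun y => fderiv ℝ φ y (ZvecL B y) := by
      filter_upwards [isOpen_compl_zero.mem_nhds hx] with y hy
      rw [dZ_toS3 B f t hy, ZvecL_apply]
    rw [dZ, he.fderiv_eq, fderiv_clm_apply hd (ZvecL B).differentiableAt]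
    simp [ZvecL_apply, add_comm]
  have hsymm := hφ2.isSymmSndFDerivAt (by simp) (Zvec A x) (Zvec B x)
  have hb := lieBracket_Zvec A B x
  rw [VectorField.lieBracket, fderiv_Zvec, fderiv_Zvec] at hb
  have hb' := congrArg (fderiv ℝ φ x) hb
  rw [map_sub, map_sum] at hb'
  simp only [map_smul] at hb'
  rw [Pi.add_apply, key A B, key B A, hsymm, Finset.sum_apply]
  simp only [Pi.smul_apply]
  change _ = _ + ∑ C, structConst A B C • fderiv ℝ φ x (Zvec C x)
  rw [← hb']
  ring

/-! Spacetime derivatives. -/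

theorem IsCk.differentiableWithinAt (hf : IsCk k T f) (hk : 1 ≤ k) {p : ℝ × E4}
    (hp : p ∈ domST T) : DifferentiableWithinAt ℝ (ext0 f) (domST T) p :=
  ContDiffOn.differentiableOn hf (by exact_mod_cast (by omega : k ≠ 0)) p hp

/-- Together with `dt_toS3`, this presents the frame and time derivatives as two contractions of one
joint differential on [0,T) × (ℝ⁴ ∖ {0}). Joint regularity of both derivatives, and their
commutation, are read off from it. -/
theorem fderiv_slice (hf : IsCk k T f) (hk : 1 ≤ k) (ht : t ∈ Ico 0 T) {y : E4} (hy : y ≠ 0)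
    (v : E4) : fderiv ℝ (fun y : E4 => f t (toS3 y)) y v
      = fderivWithin ℝ (ext0 f) (domST T) (t, y) (0, v) := by
  have h1 := (hf.differentiableWithinAt hk (p := (t, y)) ⟨ht, hy⟩).hasFDerivWithinAt
  have h2 : HasFDerivWithinAt (fun y : E4 => (t, y)) (ContinuousLinearMap.inr ℝ ℝ E4)
      {(0 : E4)}ᶜ y := (hasFDerivAt_prodMk_right t y).hasFDerivWithinAt
  have h3 := (HasFDerivWithinAt.comp y h1 h2 (fun z hz => ⟨ht, hz⟩)).hasFDerivAt
    (isOpen_compl_zero.mem_nhds hy)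
  have h4 : HasFDerivAt (fun y : E4 => f t (toS3 y)) _ y := h3
  rw [h4.fderiv]; simp

theorem hasDerivWithinAt_slice (hf : IsCk k T f) (hk : 1 ≤ k) (ht : t ∈ Ico 0 T) {y : E4}
    (hy : y ≠ 0) : HasDerivWithinAt (fun s => f s (toS3 y))
      (fderivWithin ℝ (ext0 f) (domST T) (t, y) (1, 0)) (Ico 0 T) t := by
  have h1 := (hf.differentiableWithinAt hk (p := (t, y)) ⟨ht, hy⟩).hasFDerivWithinAt
  have h2 : HasFDerivWithinAt (fun s : ℝ => (s, y)) (ContinuousLinearMap.inl ℝ ℝ E4)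
      (Ico 0 T) t := (hasFDerivAt_prodMk_left t y).hasFDerivWithinAt
  have h3 := (HasFDerivWithinAt.comp t (t := domST T) h1 h2
    (fun z hz => ⟨hz, hy⟩)).hasDerivWithinAt
  have h4 : HasDerivWithinAt (fun s => f s (toS3 y)) _ (Ico 0 T) t := h3
  simpa using h4

theorem dt_toS3 (hf : IsCk k T f) (hk : 1 ≤ k) (ht : t ∈ Ico 0 T) {y : E4} (hy : y ≠ 0) :
    dt T f t (toS3 y) = fderivWithin ℝ (ext0 f) (domST T) (t, y) (1, 0) :=
  (hasDerivWithinAt_slice hf hk ht hy).derivWithin (uniqueDiffOn_Ico 0 T t ht)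

theorem IsCk.hasDerivWithinAt (hf : IsCk k T f) (hk : 1 ≤ k) (ht : t ∈ Ico 0 T) (x : S3) :
    HasDerivWithinAt (fun s => f s x) (dt T f t x) (Ico 0 T) t := by
  have h := hasDerivWithinAt_slice hf hk ht (coe_ne_zero x)
  rw [← dt_toS3 hf hk ht (coe_ne_zero x)] at h
  simpa [toS3_coe] using h

theorem IsCk.fderivWithin (hf : IsCk (k + 1) T f) :
    ContDiffOn ℝ k (_root_.fderivWithin ℝ (ext0 f) (domST T)) (domST T) :=
  ContDiffOn.fderivWithin hf (uniqueDiffOn_domST T) (by norm_cast)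

theorem IsCk.dZ (hf : IsCk (k + 1) T f) (A : Fin 3) : IsCk k T (dZ A f) := by
  have h2 : ContDiffOn ℝ k (fun p : ℝ × E4 => ((0 : ℝ), ZvecL A p.2)) (domST T) :=
    (contDiff_const.prodMk ((ZvecL A).contDiff.comp contDiff_snd)).contDiffOn
  refine (hf.fderivWithin.clm_apply h2).congr fun p hp => ?_
  rw [dZ_toS3 A f p.1 hp.2, fderiv_slice hf (by omega) hp.1 hp.2, ZvecL_apply]

theorem IsCk.dt (hf : IsCk (k + 1) T f) : IsCk k T (dt T f) := by
  refine (hf.fderivWithin.clm_apply (contDiffOn_const (c := ((1 : ℝ), (0 : E4))))).congr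
    fun p hp => ?_
  rw [dt_toS3 hf (by omega) hp.1 hp.2]

/-- Symmetry of second derivatives within a set requires the point to lie in the closure of the
interior; this covers the boundary time t = 0. -/
theorem mem_closure_interior_domST {p : ℝ × E4} (hp : p ∈ domST T) :
    p ∈ closure (interior (domST T)) := by
  have hT : (0 : ℝ) < T := hp.1.1.trans_lt hp.1.2
  rw [domST, interior_prod_eq, closure_prod_eq, interior_Ico, closure_Ioo hT.ne,
    isOpen_compl_zero.interior_eq]
  exact ⟨Ico_subset_Icc_self hp.1, subset_closure hp.2⟩

theorem dt_dZ (hf : IsCk 2 T f) (ht : t ∈ Ico 0 T) (A : Fin 3) (x : S3) :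
    dt T (dZ A f) t x = dZ A (dt T f) t x := by
  have hx := (coe_ne_zero x)
  have hp : (t, (x : E4)) ∈ domST T := ⟨ht, hx⟩
  have hu := uniqueDiffOn_domST T _ hp
  have hd : DifferentiableWithinAt ℝ (fderivWithin ℝ (ext0 f) (domST T)) (domST T) (t, (x : E4)) :=
    (IsCk.fderivWithin (k := 1) hf).differentiableOn (by norm_num) _ hp
  have hZ : HasFDerivWithinAt (fun p : ℝ × E4 => ((0 : ℝ), ZvecL A p.2))
      ((0 : ℝ × E4 →L[ℝ] ℝ).prod ((ZvecL A).comp (ContinuousLinearMap.snd ℝ ℝ E4)))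
      (domST T) (t, (x : E4)) :=
    ((hasFDerivAt_const (0 : ℝ) _).prodMk
      ((ZvecL A).hasFDerivAt.comp _ hasFDerivAt_snd)).hasFDerivWithinAt
  have h1 : dt T (dZ A f) t x
      = fderivWithin ℝ (fderivWithin ℝ (ext0 f) (domST T)) (domST T) (t, (x : E4))
        (1, 0) (0, Zvec A x) := by
    have := dt_toS3 (IsCk.dZ (k := 1) hf A) le_rfl ht hx
    rw [toS3_coe] at this
    rw [this]
    have he : ∀ p ∈ domST T, ext0 (dZ A f) p
        = fderivWithin ℝ (ext0 f) (domST T) p ((0 : ℝ), ZvecL A p.2) := by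
      intro p hp
      rw [ext0, dZ_toS3 A f p.1 hp.2, fderiv_slice hf (by omega) hp.1 hp.2, ZvecL_apply]
    rw [fderivWithin_congr he (he _ hp), (hd.hasFDerivWithinAt.clm_apply hZ).fderivWithin hu]
    -- Differentiating the frame argument in the time direction gives (0, Z_A 0), which vanishes:
    -- the frame is time-independent.
    have h0 : ((0 : ℝ), Zvec A 0) = 0 := by rw [← ZvecL_apply, map_zero]; rfl
    simp [ZvecL_apply, h0]
  have h2 : dZ A (dt T f) t x
      = fderivWithin ℝ (fderivWithin ℝ (ext0 f) (domST T)) (domST T) (t, (x : E4))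
        (0, Zvec A x) (1, 0) := by
    rw [dZ, fderiv_slice (IsCk.dt (k := 1) hf) le_rfl ht hx]
    have he : ∀ p ∈ domST T, ext0 (dt T f) p
        = fderivWithin ℝ (ext0 f) (domST T) p ((1 : ℝ), (0 : E4)) := by
      intro p hp
      rw [ext0, dt_toS3 hf (by omega) hp.1 hp.2]
    rw [fderivWithin_congr he (he _ hp), (hd.hasFDerivWithinAt.clm_apply
      (hasFDerivWithinAt_const ((1 : ℝ), (0 : E4)) _ _)).fderivWithin hu]
    simp
  rw [h1, h2]
  exact ContDiffWithinAt.isSymmSndFDerivWithinAt (n := 2) (ContDiffOn.contDiffWithinAt hf hp)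
    (by simp) (uniqueDiffOn_domST T) (mem_closure_interior_domST hp) hp _ _

theorem dt_eq_of_hasDerivWithinAt {c : ℝ} (h : HasDerivWithinAt (fun s => f s x) c (Ico 0 T) t)
    (ht : t ∈ Ico 0 T) : dt T f t x = c :=
  h.derivWithin (uniqueDiffOn_Ico 0 T t ht)

end Regularity

/-! ### Leibniz rules for iterated Lie derivatives -/

/-- A family of first order operators `op i`, additive and local in time: `e` evaluates at a fixed
time and `R k` is the property of being of class `C^k` at that time. -/
structure IsLieOp {α δ : Type} [AddCommGroup α] [Module ℝ α] [AddCommGroup δ] [Module ℝ δ]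
    (e : α →ₗ[ℝ] δ) (R : ℕ → α → Prop) (op : Fin 3 → α → α) : Prop where
  step : ∀ k i x, R (k + 1) x → R k (op i x)
  mono : ∀ k l x, l ≤ k → R k x → R l x
  congr : ∀ i x y, e x = e y → e (op i x) = e (op i y)
  zero : R 1 0
  add_reg : ∀ k x y, R k x → R k y → R k (x + y)
  add : ∀ i x y, R 1 x → R 1 y → e (op i (x + y)) = e (op i x) + e (op i y)
  smul : ∀ i (c : ℝ) x, e (op i (c • x)) = c • e (op i x)

namespace IsLieOp

variable {α δ : Type} [AddCommGroup α] [Module ℝ α] [AddCommGroup δ] [Module ℝ δ]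
  {e : α →ₗ[ℝ] δ} {R : ℕ → α → Prop} {op : Fin 3 → α → α}

theorem opI_congr (h : IsLieOp e R op) (I : List (Fin 3)) {x y : α} (hxy : e x = e y) :
    e (opI op I x) = e (opI op I y) := by
  induction I with
  | nil => exact hxy
  | cons i I ih => exact h.congr i _ _ ih

theorem opI_reg (h : IsLieOp e R op) (I : List (Fin 3)) {k : ℕ} {x : α}
    (hx : R (k + I.length) x) : R k (opI op I x) := by
  induction I generalizing k with
  | nil => exact hx
  | cons i I ih => exact h.step _ _ _ (ih (by simpa [add_assoc, add_comm 1] using hx))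

theorem opI_add (h : IsLieOp e R op) (I : List (Fin 3)) {x y : α} (hx : R I.length x)
    (hy : R I.length y) : e (opI op I (x + y)) = e (opI op I x) + e (opI op I y) := by
  induction I with
  | nil => exact map_add e x y
  | cons i I ih =>
    have hx' := h.mono _ I.length x (by simp) hx
    have hy' := h.mono _ I.length y (by simp) hy
    have h1 : e (opI op I (x + y)) = e (opI op I x + opI op I y) := by
      rw [ih hx' hy', map_add]
    refine (h.congr i _ _ h1).trans (h.add i _ _ (h.opI_reg I ?_) (h.opI_reg I ?_))
    · simpa [add_comm] using hx
    · simpa [add_comm] using hy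

theorem opI_smul (h : IsLieOp e R op) (I : List (Fin 3)) (c : ℝ) (x : α) :
    e (opI op I (c • x)) = c • e (opI op I x) := by
  induction I with
  | nil => exact map_smul e c x
  | cons i I ih =>
    rw [← map_smul] at ih
    exact (h.congr i _ _ ih).trans (h.smul i c _)

theorem list_sum (h : IsLieOp e R op) (i : Fin 3) {σ : Type} (L : List σ) (F : σ → α)
    (hF : ∀ p ∈ L, R 1 (F p)) :
    R 1 (L.map F).sum ∧ e (op i (L.map F).sum) = (L.map fun p => e (op i (F p))).sum := by
  induction L with
  | nil =>
    refine ⟨h.zero, ?_⟩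
    have := h.smul i 0 0
    simpa using this
  | cons p L ih =>
    obtain ⟨h1, h2⟩ := ih fun q hq => hF q (List.mem_cons_of_mem _ hq)
    have h3 := hF p List.mem_cons_self
    simp only [List.map_cons, List.sum_cons]
    exact ⟨h.add_reg _ _ _ h3 h1, by rw [h.add i _ _ h3 h1, h2]⟩

end IsLieOp

/-! ### Combinatorics of the splittings of a multi-index -/

theorem length_of_mem_splits2 {I : List (Fin 3)} :
    ∀ {p : List (Fin 3) × List (Fin 3)}, p ∈ splits2 I → p.1.length + p.2.length = I.length := by
  induction I with
  | nil => intro p hp; simp [splits2] at hp; simp [hp]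
  | cons i I ih =>
    intro p hp
    simp only [splits2, List.mem_flatMap, List.mem_cons, List.not_mem_nil, or_false] at hp
    obtain ⟨q, hq, rfl | rfl⟩ := hp <;> have := ih hq <;> simp <;> omega

theorem sum_splits2_cons {M : Type*} [AddCommMonoid M] (i : Fin 3) (I : List (Fin 3))
    (F : List (Fin 3) × List (Fin 3) → M) :
    ((splits2 (i :: I)).map F).sum
      = ((splits2 I).map fun p => F (i :: p.1, p.2) + F (p.1, i :: p.2)).sum := by
  rw [splits2]
  induction splits2 I with
  | nil => simp
  | cons p L ih =>
    simp only [List.flatMap_cons, List.map_append, List.sum_append, List.map_cons, List.map_nil,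
      List.sum_cons, List.sum_nil, add_zero]
    rw [ih]

theorem sum_splits3 {M : Type*} [AddCommMonoid M] (I : List (Fin 3))
    (F : List (Fin 3) × List (Fin 3) × List (Fin 3) → M) :
    ((splits3 I).map F).sum
      = ((splits2 I).map fun p => ((splits2 p.2).map fun q => F (p.1, q.1, q.2)).sum).sum := by
  rw [splits3]
  induction splits2 I with
  | nil => simp
  | cons p L ih =>
    simp only [List.flatMap_cons, List.map_append, List.sum_append, List.map_cons,
      List.sum_cons, List.map_map, Function.comp_def]
    rw [ih]

/-- The only splitting of `I` whose first part has full length is `(I, ∅)`. -/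
theorem sum_splits2_filter {M : Type*} [AddCommMonoid M] (I : List (Fin 3))
    (F : List (Fin 3) × List (Fin 3) → M) :
    ((splits2 I).map F).sum
      = (((splits2 I).filter fun p => p.1.length < I.length).map F).sum + F (I, []) := by
  induction I generalizing F with
  | nil => simp [splits2]
  | cons i I ih =>
    have h2 := ih fun p => F (i :: p.1, p.2)
    have hlen : ∀ p ∈ splits2 I, p.1.length ≤ I.length := fun p hp => by
      have := length_of_mem_splits2 hp; omega
    -- The list is generalized so that induction applies. A pair whose first part receives `i`
    -- survives the filter exactly when it survived the old one; a pair whose second part receives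
    -- `i` always survives, because of the length bound.
    have key : ∀ L : List (List (Fin 3) × List (Fin 3)), (∀ p ∈ L, p.1.length ≤ I.length) →
        (((L.flatMap fun p => [(i :: p.1, p.2), (p.1, i :: p.2)]).filter
          fun p => p.1.length < (i :: I).length).map F).sum
        = ((L.filter fun p => p.1.length < I.length).map fun p => F (i :: p.1, p.2)).sum
          + (L.map fun p => F (p.1, i :: p.2)).sum := by
      intro L
      induction L with
      | nil => intro _; simp
      | cons p L ihL =>
        intro hL
        have hp := hL p List.mem_cons_self
        have ihL' := ihL fun q hq => hL q (List.mem_cons_of_mem _ hq)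
        simp only [List.length_cons, Nat.lt_add_one_iff] at ihL'
        by_cases hlt : p.1.length < I.length
        · simp [List.flatMap_cons, hp, hlt, ihL']
          abel
        · simp [List.flatMap_cons, hp, hlt, ihL']
          abel
    rw [sum_splits2_cons, List.sum_map_add, h2, splits2, key _ hlen]
    abel

/-- The Leibniz rule for iterated Lie derivatives of a bilinear expression. -/
theorem opI_map₂ {α β γ δα δβ δγ : Type}
    [AddCommGroup α] [Module ℝ α] [AddCommGroup δα] [Module ℝ δα]
    [AddCommGroup β] [Module ℝ β] [AddCommGroup δβ] [Module ℝ δβ]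
    [AddCommGroup γ] [Module ℝ γ] [AddCommGroup δγ] [Module ℝ δγ]
    {eα : α →ₗ[ℝ] δα} {Rα : ℕ → α → Prop} {opα : Fin 3 → α → α} (hα : IsLieOp eα Rα opα)
    {eβ : β →ₗ[ℝ] δβ} {Rβ : ℕ → β → Prop} {opβ : Fin 3 → β → β} (hβ : IsLieOp eβ Rβ opβ)
    {eγ : γ →ₗ[ℝ] δγ} {Rγ : ℕ → γ → Prop} {opγ : Fin 3 → γ → γ} (hγ : IsLieOp eγ Rγ opγ)
    (B : α → β → γ) (hR : ∀ a b, Rα 1 a → Rβ 1 b → Rγ 1 (B a b))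
    (hB : ∀ i a b, Rα 1 a → Rβ 1 b →
      eγ (opγ i (B a b)) = eγ (B (opα i a) b) + eγ (B a (opβ i b)))
    (I : List (Fin 3)) {a : α} {b : β} (ha : Rα I.length a) (hb : Rβ I.length b) :
    eγ (opI opγ I (B a b))
      = ((splits2 I).map fun p => eγ (B (opI opα p.1 a) (opI opβ p.2 b))).sum := by
  induction I with
  | nil => simp [splits2, opI]
  | cons i I ih =>
    have ih' := ih (hα.mono _ _ _ (by simp) ha) (hβ.mono _ _ _ (by simp) hb)
    -- The sum is moved inside the evaluation, so that locality in time lets the outermost operator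
    -- act on it term by term. Each term then splits in two, which is the recursion defining
    -- `splits2`.
    have hsum : eγ (opI opγ I (B a b))
        = eγ ((splits2 I).map fun p => B (opI opα p.1 a) (opI opβ p.2 b)).sum := by
      rw [ih', map_list_sum, List.map_map]; rfl
    have hra : ∀ p ∈ splits2 I, Rα 1 (opI opα p.1 a) := fun p hp =>
      hα.opI_reg _ (hα.mono _ _ _ (by
        have := length_of_mem_splits2 hp; simp only [List.length_cons]; omega) ha)
    have hrb : ∀ p ∈ splits2 I, Rβ 1 (opI opβ p.2 b) := fun p hp =>
      hβ.opI_reg _ (hβ.mono _ _ _ (by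
        have := length_of_mem_splits2 hp; simp only [List.length_cons]; omega) hb)
    refine (hγ.congr i _ _ hsum).trans ?_
    rw [(hγ.list_sum i _ _ fun p hp => hR _ _ (hra p hp) (hrb p hp)).2, sum_splits2_cons]
    refine congrArg List.sum (List.map_congr_left fun p hp => ?_)
    exact hB i _ _ (hra p hp) (hrb p hp)

/-! #### The Lie derivatives of functions and tensorfields -/

/-- Evaluation of a function at time `t`. -/
def ev0 (t : ℝ) : Scalar →ₗ[ℝ] (S3 → ℝ) where
  toFun f := f t
  map_add' _ _ := rfl
  map_smul' _ _ := rfl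

/-- Evaluation of the components of a one-form or vectorfield at time `t`. -/
def ev1 (t : ℝ) : Tensor1 →ₗ[ℝ] (Fin 3 → S3 → ℝ) where
  toFun ξ A := ξ A t
  map_add' _ _ := rfl
  map_smul' _ _ := rfl

/-- Evaluation of the components of a two-index tensorfield at time `t`. -/
def ev2 (t : ℝ) : Tensor2 →ₗ[ℝ] (Fin 3 → Fin 3 → S3 → ℝ) where
  toFun ξ A B := ξ A B t
  map_add' _ _ := rfl
  map_smul' _ _ := rfl

theorem ev0_apply (t : ℝ) (f : Scalar) : ev0 t f = f t := rfl
theorem ev1_apply (t : ℝ) (ξ : Tensor1) (A : Fin 3) : ev1 t ξ A = ξ A t := rfl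
theorem ev2_apply (t : ℝ) (ξ : Tensor2) (A B : Fin 3) : ev2 t ξ A B = ξ A B t := rfl

theorem list_sum_eval {σ : Type} (t : ℝ) (L : List σ) (F : σ → Scalar) :
    (L.map F).sum t = (L.map fun p => F p t).sum := by
  rw [← ev0_apply t (L.map F).sum, map_list_sum, List.map_map]; rfl

theorem ev1_eq_iff {t : ℝ} {ξ η : Tensor1} : ev1 t ξ = ev1 t η ↔ ∀ A, ξ A t = η A t :=
  funext_iff
theorem ev2_eq_iff {t : ℝ} {ξ η : Tensor2} :
    ev2 t ξ = ev2 t η ↔ ∀ A B, ξ A B t = η A B t := by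
  simp only [funext_iff (f := ev2 t ξ), funext_iff (f := ev2 t ξ _)]
  rfl

/-- Lie derivative of a vectorfield. -/
def lieVec (C : Fin 3) (X : Tensor1) : Tensor1 :=
  fun A => dZ C (X A) + ∑ D, structConst C D A • X D

/-- All components are of class `C^k` at time `t`. -/
def Sm1 (t : ℝ) (k : ℕ) (ξ : Tensor1) : Prop := ∀ A, Sm k t (ξ A)

/-- All components are of class `C^k` at time `t`. -/
def Sm2 (t : ℝ) (k : ℕ) (ξ : Tensor2) : Prop := ∀ A B, Sm k t (ξ A B)

theorem isLieOp_dZ (t : ℝ) : IsLieOp (ev0 t) (fun k f => Sm k t f) dZ where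
  step _ i _ h := h.dZ i
  mono _ _ _ h hx := hx.mono h
  congr i _ _ h := dZ_congr i h
  zero := Sm.zero
  add_reg _ _ _ hx hy := hx.add hy
  add i _ _ hx hy := dZ_add hx hy i
  smul i c x := by rw [dZ_smul, map_smul]

theorem isLieOp_lieForm (t : ℝ) : IsLieOp (ev1 t) (Sm1 t) lieForm where
  step k i x h A := ((h A).dZ i).sub (Sm.sum fun D _ => ((h D).mono (by omega)).smul _)
  mono _ _ _ h hx A := (hx A).mono h
  congr i x y h := by
    rw [ev1_eq_iff] at h ⊢
    intro A
    simp [lieForm, dZ_congr i (h A), h]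
  zero _ := Sm.zero
  add_reg _ _ _ hx hy A := (hx A).add (hy A)
  add i x y hx hy := by
    funext A
    simp only [ev1_apply, Pi.add_apply, lieForm, Pi.sub_apply, dZ_add (hx A) (hy A),
      smul_add, Finset.sum_add_distrib]
    abel
  smul i c x := by
    funext A
    simp only [ev1_apply, Pi.smul_apply, lieForm, Pi.sub_apply, dZ_smul, smul_sub,
      Finset.smul_sum, smul_comm c, Finset.sum_apply]

theorem isLieOp_lieVec (t : ℝ) : IsLieOp (ev1 t) (Sm1 t) lieVec where
  step k i x h A := ((h A).dZ i).add (Sm.sum fun D _ => ((h D).mono (by omega)).smul _)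
  mono _ _ _ h hx A := (hx A).mono h
  congr i x y h := by
    rw [ev1_eq_iff] at h ⊢
    intro A
    simp [lieVec, dZ_congr i (h A), h]
  zero _ := Sm.zero
  add_reg _ _ _ hx hy A := (hx A).add (hy A)
  add i x y hx hy := by
    funext A
    simp only [ev1_apply, Pi.add_apply, lieVec, dZ_add (hx A) (hy A),
      smul_add, Finset.sum_add_distrib]
    abel
  smul i c x := by
    funext A
    simp only [ev1_apply, Pi.smul_apply, lieVec, Pi.add_apply, dZ_smul, smul_add,
      Finset.smul_sum, smul_comm c, Finset.sum_apply]

theorem isLieOp_lieCon (t : ℝ) : IsLieOp (ev2 t) (Sm2 t) lieCon where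
  step k i x h A B := (((h A B).dZ i).add
    (Sm.sum fun D _ => ((h D B).mono (by omega)).smul _)).add
    (Sm.sum fun D _ => ((h A D).mono (by omega)).smul _)
  mono _ _ _ h hx A B := (hx A B).mono h
  congr i x y h := by
    rw [ev2_eq_iff] at h ⊢
    intro A B
    simp [lieCon, dZ_congr i (h A B), h]
  zero _ _ := Sm.zero
  add_reg _ _ _ hx hy A B := (hx A B).add (hy A B)
  add i x y hx hy := by
    funext A B
    simp only [ev2_apply, Pi.add_apply, lieCon, dZ_add (hx A B) (hy A B),
      smul_add, Finset.sum_add_distrib]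
    abel
  smul i c x := by
    funext A B
    simp only [ev2_apply, Pi.smul_apply, lieCon, Pi.add_apply, dZ_smul, smul_add,
      Finset.smul_sum, smul_comm c, Finset.sum_apply]

theorem isLieOp_lieMix (t : ℝ) : IsLieOp (ev2 t) (Sm2 t) lieMix where
  step k i x h A B := (((h A B).dZ i).add
    (Sm.sum fun D _ => ((h D B).mono (by omega)).smul _)).sub
    (Sm.sum fun D _ => ((h A D).mono (by omega)).smul _)
  mono _ _ _ h hx A B := (hx A B).mono h
  congr i x y h := by
    rw [ev2_eq_iff] at h ⊢
    intro A B
    simp [lieMix, dZ_congr i (h A B), h]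
  zero _ _ := Sm.zero
  add_reg _ _ _ hx hy A B := (hx A B).add (hy A B)
  add i x y hx hy := by
    funext A B
    simp only [ev2_apply, Pi.add_apply, lieMix, Pi.sub_apply, dZ_add (hx A B) (hy A B),
      smul_add, Finset.sum_add_distrib]
    abel
  smul i c x := by
    funext A B
    simp only [ev2_apply, Pi.smul_apply, lieMix, Pi.add_apply, Pi.sub_apply, dZ_smul, smul_add,
      smul_sub, Finset.smul_sum, smul_comm c, Finset.sum_apply]

/-! ### Leibniz rules for products, contractions and differentials -/

section Rules

variable {t : ℝ} {f g : Scalar} {I : List (Fin 3)}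

theorem zI_congr (I : List (Fin 3)) (h : f t = g t) : zI I f t = zI I g t :=
  (isLieOp_dZ t).opI_congr I h

theorem lieFormI_congr (I : List (Fin 3)) {ξ η : Tensor1} (h : ∀ A, ξ A t = η A t) (A : Fin 3) :
    lieFormI I ξ A t = lieFormI I η A t :=
  congrFun ((isLieOp_lieForm t).opI_congr I (ev1_eq_iff.mpr h)) A

theorem zI_mul (hf : Sm I.length t f) (hg : Sm I.length t g) :
    zI I (f * g) t = ((splits2 I).map fun p => zI p.1 f * zI p.2 g).sum t := by
  have h := opI_map₂ (isLieOp_dZ t) (isLieOp_dZ t) (isLieOp_dZ t) (fun f g => f * g)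
    (fun _ _ h1 h2 => h1.mul h2) (fun i a b ha hb => dZ_mul ha hb i) I hf hg
  rw [list_sum_eval]
  exact h

/-- Lie derivatives commute with contractions: the structure-constant terms of upper and lower
indices cancel in the trace. In the commuted lapse equation this handles |K|² once it is written as
tr K², so no derivatives of the metric appear. -/
theorem zI_trace {K L : Tensor2} (hK : Sm2 t I.length K) (hL : Sm2 t I.length L) :
    zI I (∑ A, ∑ B, K A B * L B A) t
      = ((splits2 I).map fun p => ∑ A, ∑ B, lieMixI p.1 K A B * lieMixI p.2 L B A).sum t := by
  have h := opI_map₂ (isLieOp_lieMix t) (isLieOp_lieMix t) (isLieOp_dZ t)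
    (fun K L => ∑ A, ∑ B, K A B * L B A)
    (fun a b h1 h2 => Sm.sum fun A _ => Sm.sum fun B _ => (h1 A B).mul (h2 B A))
    (fun i a b ha hb => by
      rw [ev0_apply, dZ_sum fun A _ => Sm.sum fun B _ => (ha A B).mul (hb B A)]
      simp only [dZ_sum fun B _ => (ha _ B).mul (hb B _), dZ_mul (ha _ _) (hb _ _)]
      funext x
      simp [ev0_apply, lieMix, Fin.sum_univ_three]
      ring) I hK hL
  rw [list_sum_eval]
  exact h

theorem zI_contract {ξ X : Tensor1} (hξ : Sm1 t I.length ξ) (hX : Sm1 t I.length X) :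
    zI I (∑ A, ξ A * X A) t
      = ((splits2 I).map fun p => ∑ A, lieFormI p.1 ξ A * opI lieVec p.2 X A).sum t := by
  have h := opI_map₂ (isLieOp_lieForm t) (isLieOp_lieVec t) (isLieOp_dZ t)
    (fun ξ X => ∑ A, ξ A * X A)
    (fun a b h1 h2 => Sm.sum fun A _ => (h1 A).mul (h2 A))
    (fun i a b ha hb => by
      rw [ev0_apply, dZ_sum fun A _ => (ha A).mul (hb A)]
      simp only [dZ_mul (ha _) (hb _)]
      funext x
      simp [ev0_apply, lieForm, lieVec, Fin.sum_univ_three]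
      ring) I hξ hX
  rw [list_sum_eval]
  exact h

/-- The pairing of a contravariant tensor with a one-form takes values in vectorfields, so `lieVec`
is the operator on the target. It is only an intermediate object in the triple Leibniz sum. -/
theorem lieVecI_raise {M : Tensor2} {η : Tensor1} (hM : Sm2 t I.length M)
    (hη : Sm1 t I.length η) (A : Fin 3) :
    opI lieVec I (fun A => ∑ B, M A B * η B) A t
      = ((splits2 I).map fun p => ∑ B, lieConI p.1 M A B * lieFormI p.2 η B).sum t := by
  have h := opI_map₂ (isLieOp_lieCon t) (isLieOp_lieForm t) (isLieOp_lieVec t)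
    (fun M η => (fun A => ∑ B, M A B * η B : Tensor1))
    (fun a b h1 h2 A => Sm.sum fun B _ => (h1 A B).mul (h2 B))
    (fun i a b ha hb => by
      funext A
      rw [Pi.add_apply, ev1_apply, lieVec, Pi.add_apply,
        dZ_sum fun B _ => (ha A B).mul (hb B)]
      simp only [dZ_mul (ha _ _) (hb _)]
      funext x
      simp [ev1_apply, lieForm, lieCon, Fin.sum_univ_three]
      ring) I hM hη
  have h2 := congrFun h A
  rw [ev1_apply] at h2
  rw [h2, list_sum_eval]
  clear h h2
  induction splits2 I with
  | nil => rfl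
  | cons p L ih => simp only [List.map_cons, List.sum_cons, Pi.add_apply, ih]; rfl

/-- The bracket term in Z_i Z_A f is exactly what the structure constants in `lieForm` subtract,
leaving Z_A Z_i f. This is Cartan's commutation of the Lie derivative with d. -/
theorem lieFormI_grad (hf : Sm (I.length + 1) t f) (A : Fin 3) :
    lieFormI I (grad f) A t = grad (zI I f) A t := by
  induction I generalizing A with
  | nil => rfl
  | cons i I ih =>
    have ih' := ih (hf.mono (by simp))
    have hz : Sm 2 t (zI I f) :=
      (isLieOp_dZ t).opI_reg I (hf.mono (by simp only [List.length_cons]; omega))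
    have h1 := (isLieOp_lieForm t).congr i _ _ (ev1_eq_iff.mpr ih')
    refine (ev1_eq_iff.mp h1 A).trans ?_
    simp only [lieForm, grad, Pi.sub_apply, dZ_comm hz i A, Finset.sum_apply, Pi.smul_apply]
    change _ = dZ A (dZ i (zI I f)) t
    abel

/-- Two Leibniz rules are nested: first for the pairing of dψ with M·η, then for M·η itself, with
the splitting of the second part resolved by `sum_splits3`. -/
theorem zI_contract_raise {ψ : Scalar} {M : Tensor2} {η : Tensor1}
    (hψ : Sm (I.length + 1) t ψ) (hM : Sm2 t I.length M) (hη : Sm1 t I.length η) (x : S3) :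
    zI I (∑ A, grad ψ A * ∑ B, M A B * η B) t x
      = ((splits3 I).map fun p => ∑ A, ∑ B, grad (zI p.1 ψ) A * lieConI p.2.1 M A B
          * lieFormI p.2.2 η B).sum t x := by
  rw [zI_contract (ξ := grad ψ) (X := fun A => ∑ B, M A B * η B) (fun A => hψ.dZ A)
    (fun A => Sm.sum fun B _ => (hM A B).mul (hη B)), sum_splits3, list_sum_eval, list_sum_eval]
  refine congrFun ?_ x
  refine congrArg List.sum (List.map_congr_left fun p hp => ?_)
  have hl := length_of_mem_splits2 hp
  funext x
  simp only [Finset.sum_apply, Pi.mul_apply,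
    lieFormI_grad (hψ.mono (by omega : p.1.length + 1 ≤ I.length + 1)),
    lieVecI_raise (I := p.2) (fun A B => (hM A B).mono (by omega : p.2.length ≤ I.length))
      (fun A => (hη A).mono (by omega : p.2.length ≤ I.length))]
  induction splits2 p.2 with
  | nil => simp
  | cons q L ih =>
    simp only [List.map_cons, List.sum_cons, Pi.add_apply, mul_add, Finset.sum_add_distrib]
    rw [ih]
    congr 1
    simp only [Finset.sum_apply, Pi.mul_apply, Finset.mul_sum, mul_assoc]

/-! #### Time derivatives -/

variable {T : ℝ} {k : ℕ}

theorem IsCk.zI {I : List (Fin 3)} (hf : IsCk (k + I.length) T f) : IsCk k T (zI I f) := by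
  induction I generalizing k with
  | nil => exact hf
  | cons i I ih => exact (ih (by simpa [add_assoc, add_comm 1] using hf)).dZ i

theorem IsCk.lieFormI {I : List (Fin 3)} {ξ : Tensor1} (hξ : ∀ A, IsCk (k + I.length) T (ξ A))
    (A : Fin 3) : IsCk k T (lieFormI I ξ A) := by
  induction I generalizing k A with
  | nil => exact hξ A
  | cons i I ih =>
    have h : ∀ A, IsCk (k + 1) T (ScalarFieldCurrent.lieFormI I ξ A) :=
      ih (by simpa [add_assoc, add_comm 1] using hξ)
    exact ((h A).dZ i).sub (IsCk.sum fun D _ => ((h D).mono (by omega)).smul _)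

/-- At each induction step the inner iterate is still C², which is what `dt_dZ` needs for its
outermost derivative. -/
theorem dt_zI (hf : IsCk (I.length + 1) T f) (ht : t ∈ Ico 0 T) (x : S3) :
    dt T (zI I f) t x = zI I (dt T f) t x := by
  induction I generalizing t x with
  | nil => rfl
  | cons i I ih =>
    have ih' : ∀ x, dt T (zI I f) t x = zI I (dt T f) t x :=
      fun x => ih (hf.mono (by simp)) ht x
    have hz : IsCk 2 T (zI I f) :=
      IsCk.zI (hf.mono (by simp only [List.length_cons]; omega))
    refine (dt_dZ hz ht i x).trans ?_
    exact congrFun (dZ_congr i (funext ih')) x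

theorem dt_lieFormI {ξ : Tensor1} (hξ : ∀ A, IsCk (I.length + 1) T (ξ A)) (ht : t ∈ Ico 0 T)
    (A : Fin 3) (x : S3) :
    dt T (lieFormI I ξ A) t x = lieFormI I (fun B => dt T (ξ B)) A t x := by
  induction I generalizing A x with
  | nil => rfl
  | cons i I ih =>
    have ih' : ∀ A, dt T (lieFormI I ξ A) t = lieFormI I (fun B => dt T (ξ B)) A t :=
      fun A => funext fun x => ih (fun A => (hξ A).mono (by simp)) A x
    have hz : ∀ A, IsCk 2 T (lieFormI I ξ A) :=
      IsCk.lieFormI fun A => (hξ A).mono (by simp only [List.length_cons]; omega)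
    have h1 := ev1_eq_iff.mp ((isLieOp_lieForm t).congr i (fun A => dt T (lieFormI I ξ A)) _
      (ev1_eq_iff.mpr ih')) A
    refine Eq.trans ?_ (congrFun h1 x)
    refine dt_eq_of_hasDerivWithinAt ?_ ht
    have hd := ((hz A).dZ i).hasDerivWithinAt le_rfl ht x
    rw [dt_dZ (hz A) ht i x] at hd
    have hs := HasDerivWithinAt.fun_sum (u := Finset.univ) fun D (_ : D ∈ Finset.univ) =>
      ((hz D).hasDerivWithinAt (by omega) ht x).const_mul (structConst i A D)
    convert hd.sub hs using 1
    · rfl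
    · rfl
    · funext s
      change lieForm i (lieFormI I ξ) A s x = _
      simp [lieForm]
    · simp [lieForm]

end Rules

/-! ### The inverse metric and the divergence -/

/-- The matrix of components of `G` at a point. -/
def gramMatrix (G : Tensor2) (t : ℝ) (x : S3) : Matrix (Fin 3) (Fin 3) ℝ :=
  Matrix.of fun A B => G A B t x

section Metric

variable {G : Tensor2} {T t : ℝ} {x : S3} {m k : ℕ}

theorem invMetric_eq (G : Tensor2) (A B : Fin 3) (t : ℝ) (x : S3) :
    invMetric G A B t x = (gramMatrix G t x)⁻¹ A B := rfl

theorem metric_symm (h : (gramMatrix G t x).PosDef) (A B : Fin 3) : G A B t x = G B A t x := by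
  have := h.isHermitian.apply B A
  simpa [gramMatrix] using this

theorem invMetric_symm (h : (gramMatrix G t x).PosDef) (A B : Fin 3) :
    invMetric G A B t x = invMetric G B A t x := by
  have := h.inv.isHermitian.apply B A
  simpa [invMetric_eq] using this

theorem invMetric_mul (h : (gramMatrix G t x).PosDef) (A C : Fin 3) :
    ∑ B, invMetric G A B t x * G B C t x = if A = C then 1 else 0 := by
  have h1 := Matrix.nonsing_inv_mul (gramMatrix G t x) (isUnit_iff_ne_zero.mpr h.det_pos.ne')
  have h2 := congrFun (congrFun h1 A) C
  rw [Matrix.mul_apply, Matrix.one_apply] at h2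
  exact h2

theorem mul_invMetric (h : (gramMatrix G t x).PosDef) (A C : Fin 3) :
    ∑ B, G A B t x * invMetric G B C t x = if A = C then 1 else 0 := by
  have h1 := Matrix.mul_nonsing_inv (gramMatrix G t x) (isUnit_iff_ne_zero.mpr h.det_pos.ne')
  have h2 := congrFun (congrFun h1 A) C
  rw [Matrix.mul_apply, Matrix.one_apply] at h2
  exact h2

/-- By Cramer's rule the entries of the inverse are polynomials in the entries of G divided by the
determinant, which is positive. -/
theorem IsCk.invMetric (hG : ∀ A B, IsCk m T (G A B))
    (h : ∀ t ∈ Ico 0 T, ∀ x, (gramMatrix G t x).PosDef) (A B : Fin 3) :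
    IsCk m T (invMetric G A B) := by
  have hdet : IsCk m T (fun t x => (gramMatrix G t x).det) := by
    have he : (fun t x => (gramMatrix G t x).det) = G 0 0 * G 1 1 * G 2 2 - G 0 0 * G 1 2 * G 2 1
        - G 0 1 * G 1 0 * G 2 2 + G 0 1 * G 1 2 * G 2 0 + G 0 2 * G 1 0 * G 2 1
        - G 0 2 * G 1 1 * G 2 0 := by
      funext t x
      rw [Matrix.det_fin_three]
      rfl
    rw [he]
    have h3 : ∀ A B C D E F, IsCk m T (G A B * G C D * G E F) := fun A B C D E F =>
      ((hG A B).mul (hG C D)).mul (hG E F)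
    exact (((((h3 _ _ _ _ _ _).sub (h3 _ _ _ _ _ _)).sub (h3 _ _ _ _ _ _)).add
      (h3 _ _ _ _ _ _)).add (h3 _ _ _ _ _ _)).sub (h3 _ _ _ _ _ _)
  have hadj : IsCk m T (fun t x => (gramMatrix G t x).adjugate A B) := by
    have h2 : ∀ A B C D E F E' F', IsCk m T (G A B * G C D - G E F * G E' F') :=
      fun A B C D E F E' F' => ((hG A B).mul (hG C D)).sub ((hG E F).mul (hG E' F'))
    have h2' : ∀ A B C D E F E' F', IsCk m T (-(G A B * G C D) + G E F * G E' F') :=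
      fun A B C D E F E' F' => ((hG A B).mul (hG C D)).neg.add ((hG E F).mul (hG E' F'))
    simp only [Matrix.adjugate_fin_three]
    fin_cases A <;> fin_cases B <;> first | exact h2 _ _ _ _ _ _ _ _ | exact h2' _ _ _ _ _ _ _ _
  have hinv : IsCk m T (fun t x => ((gramMatrix G t x).det)⁻¹) :=
    ContDiffOn.inv hdet fun p hp => (h p.1 hp.1 _).det_pos.ne'
  have he : ScalarFieldCurrent.invMetric G A B
      = (fun t x => ((gramMatrix G t x).det)⁻¹) * fun t x => (gramMatrix G t x).adjugate A B := by
    funext t x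
    rw [invMetric_eq, Matrix.inv_def, Ring.inverse_eq_inv']
    rfl
  rw [he]
  exact hinv.mul hadj

/-- The derivative of the inverse metric. -/
theorem dZ_invMetric (hG : ∀ A B, Sm 1 t (G A B)) (hI : ∀ A B, Sm 1 t (invMetric G A B))
    (h : ∀ x, (gramMatrix G t x).PosDef) (C A F : Fin 3) :
    dZ C (invMetric G A F) t x
      = -∑ B, ∑ E, invMetric G A B t x * dZ C (G B E) t x * invMetric G E F t x := by
  have key : ∀ E, ∑ B, dZ C (invMetric G A B) t x * G B E t x
      = -∑ B, invMetric G A B t x * dZ C (G B E) t x := by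
    intro E
    let δ : Scalar := fun _ _ => if A = E then 1 else 0
    have h1 : (∑ B, invMetric G A B * G B E) t = δ t := by
      funext x
      change _ = if A = E then (1 : ℝ) else 0
      simpa using invMetric_mul (h x) A E
    have h2 := congrFun (dZ_congr C h1) x
    rw [dZ_const C (if A = E then 1 else 0), dZ_sum fun B _ => (hI A B).mul (hG B E)] at h2
    simp only [dZ_mul (hI _ _) (hG _ _), Finset.sum_apply, Pi.add_apply, Pi.mul_apply,
      Finset.sum_add_distrib, Pi.zero_apply] at h2
    linarith
  have h3 : dZ C (invMetric G A F) t x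
      = ∑ E, (∑ B, dZ C (invMetric G A B) t x * G B E t x) * invMetric G E F t x := by
    simp only [Finset.sum_mul, mul_assoc]
    rw [Finset.sum_comm]
    simp only [← Finset.mul_sum, mul_invMetric (h x)]
    simp
  rw [h3]
  simp only [key, neg_mul, Finset.sum_neg_distrib, Finset.sum_mul]
  rw [Finset.sum_comm]

/-! ### Metric compatibility and the divergence of a one-form -/

/-- The connection coefficients with lowered index, `G(∇_{Z_A} Z_B, Z_C)`. -/
def lowGam (G : Tensor2) (A B C : Fin 3) : Scalar :=
  (1 / 2 : ℝ) • (dZ A (G B C) + dZ B (G A C) - dZ C (G A B)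
      + ∑ E, (structConst A B E • G E C - structConst A C E • G E B - structConst B C E • G E A))

theorem Gam_eq (A D B : Fin 3) : Gam G A D B = ∑ C, invMetric G C D * lowGam G A B C := rfl

theorem structConst_antisymm (A B C : Fin 3) : structConst A B C = -structConst B A C := by
  simp only [structConst, eps]; ring

/-- The Levi-Civita connection is compatible with the metric. -/
theorem lowGam_add (h : ∀ x, (gramMatrix G t x).PosDef) (A B C : Fin 3) :
    lowGam G A B C t x + lowGam G A C B t x = dZ A (G B C) t x := by
  have hs : ∀ D A B, dZ D (G A B) t x = dZ D (G B A) t x := fun D A B =>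
    congrFun (dZ_congr D (funext fun x => metric_symm (h x) A B)) x
  simp only [lowGam, Pi.smul_apply, Pi.add_apply, Pi.sub_apply, Finset.sum_apply, smul_eq_mul,
    Finset.sum_sub_distrib]
  rw [hs A C B, hs C A B, hs B A C]
  have : ∑ E, structConst C B E * G E A t x = -∑ E, structConst B C E * G E A t x := by
    rw [← Finset.sum_neg_distrib]
    exact Finset.sum_congr rfl fun E _ => by rw [structConst_antisymm C B E]; ring
  rw [this, hs C B A]
  ring

theorem divG_smul {f : Scalar} {X : Tensor1} (hf : Sm 1 t f) (hX : Sm1 t 1 X) :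
    divG G (fun A => f * X A) t x
      = f t x * divG G X t x + ∑ A, dZ A f t x * X A t x := by
  simp only [divG, divVec, Finset.sum_apply, Pi.add_apply, dZ_mul hf (hX _), Pi.mul_apply,
    Finset.mul_sum, mul_add, Finset.sum_add_distrib]
  have : ∀ A B, christoffel dZ structConst G A A B t x * (f t x * X B t x)
    = f t x * (christoffel dZ structConst G A A B t x * X B t x) := fun A B => by ring
  simp only [this]
  ring

theorem divG_congr {X Y : Tensor1} (h : ∀ A, X A t = Y A t) : divG G X t x = divG G Y t x := by
  simp only [divG, divVec, Finset.sum_apply, Pi.add_apply, dZ_congr _ (h _), Pi.mul_apply, h]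

/-- This is the index algebra behind `divG_sharp`, with h = G⁻¹ and K the lowered connection
coefficients. Differentiating G⁻¹ gives two terms by metric compatibility; one cancels the
connection trace in the divergence of the vectorfield, the other is the connection term of the
one-form. -/
theorem sum_christoffel_identity (h : Fin 3 → Fin 3 → ℝ) (K : Fin 3 → Fin 3 → Fin 3 → ℝ)
    (hs : ∀ A B, h A B = h B A) (ω : Fin 3 → ℝ) :
    ∑ A, (∑ B, (-∑ D, ∑ E, h A D * (K A D E + K A E D) * h E B) * ω B
        + ∑ B, (∑ C, h C A * K A B C) * ∑ D, h B D * ω D)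
      = -∑ A, ∑ B, h A B * ∑ D, (∑ C, h C D * K A B C) * ω D := by
  have h10 := hs 1 0
  have h20 := hs 2 0
  have h21 := hs 2 1
  simp only [Fin.sum_univ_three, h10, h20, h21]
  ring

/-- The divergence of a one-form is the divergence of the metrically equivalent vectorfield. -/
theorem divG_sharp (hG : ∀ A B, Sm 1 t (G A B)) (hI : ∀ A B, Sm 1 t (invMetric G A B))
    (h : ∀ x, (gramMatrix G t x).PosDef) {ω : Tensor1} (hω : Sm1 t 1 ω) :
    divG G (sharp G ω) t x = divForm G ω t x := by
  have key := sum_christoffel_identity (fun A B => invMetric G A B t x)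
    (fun A B C => lowGam G A B C t x) (invMetric_symm (h x)) (fun A => ω A t x)
  have h1 : ∀ A, dZ A (sharp G ω A) t x
      = ∑ B, (-∑ D, ∑ E, invMetric G A D t x * (lowGam G A D E t x + lowGam G A E D t x)
            * invMetric G E B t x) * ω B t x
        + ∑ B, invMetric G A B t x * dZ A (ω B) t x := by
    intro A
    rw [sharp, dZ_sum fun B _ => (hI A B).mul (hω B), ← Finset.sum_add_distrib]
    simp only [dZ_mul (hI _ _) (hω _), Finset.sum_apply, Pi.add_apply, Pi.mul_apply,
      dZ_invMetric hG hI h, lowGam_add h]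
  have hL : divG G (sharp G ω) t x = ∑ A, (∑ B, (-∑ D, ∑ E, invMetric G A D t x *
          (lowGam G A D E t x + lowGam G A E D t x) * invMetric G E B t x) * ω B t x
        + ∑ B, (∑ C, invMetric G C A t x * lowGam G A B C t x) * ∑ D, invMetric G B D t x * ω D t x)
        + ∑ A, ∑ B, invMetric G A B t x * dZ A (ω B) t x := by
    have : divG G (sharp G ω) t x
        = ∑ A, (dZ A (sharp G ω A) t x + ∑ B, Gam G A A B t x * sharp G ω B t x) := by
      simp only [divG, divVec, Finset.sum_apply, Pi.add_apply, Pi.mul_apply]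
      rfl
    rw [this, ← Finset.sum_add_distrib]
    refine Finset.sum_congr rfl fun A _ => ?_
    rw [h1]
    simp only [Gam_eq, sharp, Finset.sum_apply, Pi.mul_apply]
    ring
  rw [hL, key]
  simp only [divForm, covForm, Gam_eq, Finset.sum_apply, Pi.mul_apply, Pi.sub_apply, mul_sub,
    Finset.sum_sub_distrib]
  ring

/-! Regularity of the differential operators of the metric. -/

theorem Sm.christoffel (hG : ∀ A B, Sm (k + 1) t (G A B))
    (hI : ∀ A B, Sm (k + 1) t (invMetric G A B)) (A D B : Fin 3) : Sm k t (Gam G A D B) := by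
  have hm : ∀ {f}, Sm (k + 1) t f → Sm k t f := fun h => h.mono (by omega)
  rw [Gam_eq]
  refine Sm.sum fun C _ => (hm (hI C D)).mul (Sm.smul _ ?_)
  exact ((((hG B C).dZ A).add ((hG A C).dZ B)).sub ((hG A B).dZ C)).add
    (Sm.sum fun E _ => (((hm (hG E C)).smul _).sub ((hm (hG E B)).smul _)).sub
      ((hm (hG E A)).smul _))

theorem Sm.divForm (hG : ∀ A B, Sm (k + 1) t (G A B))
    (hI : ∀ A B, Sm (k + 1) t (invMetric G A B)) {ω : Tensor1} (hω : Sm1 t (k + 1) ω) :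
    Sm k t (divForm G ω) :=
  Sm.sum fun A _ => Sm.sum fun B _ => ((hI A B).mono (by omega)).mul
    (((hω B).dZ A).sub (Sm.sum fun D _ => (Sm.christoffel hG hI A D B).mul
      ((hω D).mono (by omega))))

/-! ### The spacetime divergence -/

theorem invMetric_auxMetric (h : (gramMatrix G t x).PosDef) :
    invMetric (auxMetric G) (.inl ()) (.inl ()) t x = -1
    ∧ (∀ A, invMetric (auxMetric G) (.inl ()) (.inr A) t x = 0)
    ∧ (∀ A, invMetric (auxMetric G) (.inr A) (.inl ()) t x = 0)
    ∧ ∀ A B, invMetric (auxMetric G) (.inr A) (.inr B) t x = invMetric G A B t x := by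
  have h1 : (Matrix.of fun C D => auxMetric G C D t x)
      = Matrix.fromBlocks (-1) 0 0 (gramMatrix G t x) := by
    ext i j
    rcases i with i | i <;> rcases j with j | j <;> simp [auxMetric, gramMatrix]
  have h2 : (Matrix.of fun C D => auxMetric G C D t x)⁻¹
      = Matrix.fromBlocks (-1) 0 0 (gramMatrix G t x)⁻¹ := by
    rw [h1]
    apply Matrix.inv_eq_right_inv
    rw [Matrix.fromBlocks_multiply, Matrix.mul_nonsing_inv _ (isUnit_iff_ne_zero.mpr h.det_pos.ne')]
    simp
  simp only [invMetric, h2]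
  refine ⟨by simp, by simp, by simp, fun A B => ?_⟩
  rw [Matrix.fromBlocks_apply₂₂]
  rfl

theorem dt_const (T c : ℝ) : dt T (fun _ _ => c) = 0 := by
  funext t x; simp [dt]

/-- Because the metric is block diagonal with constant time-time entry, the traces of the connection
coefficients reduce to the spatial ones and to ½ tr(G⁻¹ ∂_t G), the logarithmic time derivative of
the volume element. -/
theorem divST_eq (h : (gramMatrix G t x).PosDef) (J : STIndex → Scalar) :
    divST T G J t x = dt T (J (.inl ())) t x
      + (1 / 2) * (∑ A, ∑ C, invMetric G C A t x * dt T (G A C) t x) * J (.inl ()) t x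
      + divG G (fun A => J (.inr A)) t x := by
  obtain ⟨h00, h0i, hi0, hij⟩ := invMetric_auxMetric h
  have ht0 : dt T 0 = 0 := dt_const T 0
  have ht1 : dt T (-1) = 0 := dt_const T (-1)
  have hz1 : ∀ A, dZ A (-1) = 0 := fun A => dZ_const A (-1)
  have hz0 : ∀ A, dZ A 0 = 0 := fun A => dZ_const A 0
  have e1 : christoffel (dST T) structConstST (auxMetric G) (.inl ()) (.inl ()) (.inl ()) t x
      = 0 := by
    simp [christoffel, h00, hi0, Fintype.sum_sum_type, dST, auxMetric, ht1]
    rfl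
  have e2 : ∀ B, christoffel (dST T) structConstST (auxMetric G) (.inl ()) (.inl ()) (.inr B) t x
      = 0 := by
    intro B
    simp [christoffel, h00, hi0, Fintype.sum_sum_type, dST, auxMetric, structConstST, ht0, hz1]
  have e3 : ∀ A, christoffel (dST T) structConstST (auxMetric G) (.inr A) (.inr A) (.inl ()) t x
      = (1 / 2) * ∑ C, invMetric G C A t x * dt T (G A C) t x := by
    intro A
    simp [christoffel, h0i, hij, Fintype.sum_sum_type, dST, auxMetric, structConstST, hz0,
      Finset.mul_sum]
  have e4 : ∀ A B, christoffel (dST T) structConstST (auxMetric G) (.inr A) (.inr A) (.inr B) t x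
      = christoffel dZ structConst G A A B t x := by
    intro A B
    simp [christoffel, h0i, hij, Fintype.sum_sum_type, dST, auxMetric, structConstST]
  simp only [divST, divG, divVec, Fintype.sum_sum_type, Finset.univ_unique, Finset.sum_singleton,
    Finset.sum_apply, Pi.add_apply, Pi.mul_apply, PUnit.default_eq_unit, e1, e2, e3, e4]
  simp only [dST, zero_mul, Finset.sum_const_zero, add_zero, Finset.sum_add_distrib,
    Finset.mul_sum, Finset.sum_mul]
  ring

/-! ### Norms -/

theorem invMetric_quadratic_nonneg (h : (gramMatrix G t x).PosDef) (v : Fin 3 → ℝ) :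
    0 ≤ ∑ A, ∑ B, invMetric G A B t x * v A * v B := by
  have h1 := h.inv.posSemidef.dotProduct_mulVec_nonneg v
  simp only [dotProduct, Matrix.mulVec, Finset.mul_sum, star_trivial] at h1
  refine h1.trans_eq (Finset.sum_congr rfl fun A _ => Finset.sum_congr rfl fun B _ => ?_)
  rw [invMetric_eq]
  ring

theorem normSqForm_nonneg (h : (gramMatrix G t x).PosDef) (ξ : Tensor1) :
    0 ≤ normSqForm G ξ t x := by
  simpa [normSqForm] using invMetric_quadratic_nonneg h fun A => ξ A t x

/-- Writing G as a sum of rank-one squares v_i ⊗ v_i turns |K|² into the sum of the squared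
G⁻¹-norms of the one-forms v_i · K. -/
theorem normSqMix_nonneg (h : (gramMatrix G t x).PosDef) (K : Tensor2) :
    0 ≤ normSqMix G K t x := by
  obtain ⟨n, v, hv⟩ := Matrix.posSemidef_iff_eq_sum_vecMulVec.mp h.posSemidef
  have hG : ∀ A B, G A B t x = ∑ i, v i A * v i B := by
    intro A B
    have := congrFun (congrFun hv A) B
    simpa [gramMatrix, Matrix.sum_apply, Matrix.vecMulVec_apply] using this
  have h1 : normSqMix G K t x = ∑ i, ∑ B, ∑ B', invMetric G B B' t x
      * (∑ A, v i A * K A B t x) * (∑ A, v i A * K A B' t x) := by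
    simp only [normSqMix, Finset.sum_apply, Pi.mul_apply, hG]
    simp only [Fin.sum_univ_three, Finset.sum_mul, ← Finset.sum_add_distrib]
    exact Finset.sum_congr rfl fun i _ => by ring
  rw [h1]
  exact Finset.sum_nonneg fun i _ => invMetric_quadratic_nonneg h _

/-- For `K` with `G · K` symmetric, `|K|²` is the trace of `K²`. -/
theorem normSqMix_eq_trace (h : (gramMatrix G t x).PosDef) {K : Tensor2}
    (hs : ∀ A B, (∑ C, G A C * K C B) t x = (∑ C, G B C * K C A) t x) :
    normSqMix G K t x = (∑ A, ∑ B, K A B * K B A) t x := by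
  have hs' : ∀ A B, ∑ C, G A C t x * K C B t x = ∑ C, G B C t x * K C A t x := by
    simpa using hs
  -- Symmetry of G·K moves the free index to the other side, after which G⁻¹ cancels G: the doubly
  -- contracted K becomes K with its indices exchanged.
  have h1 : ∀ A' B, ∑ B', invMetric G B B' t x * (∑ C, G A' C t x * K C B' t x)
      = K B A' t x := by
    intro A' B
    simp only [hs' A']
    simp only [Finset.mul_sum, ← mul_assoc]
    rw [Finset.sum_comm]
    simp only [← Finset.sum_mul, invMetric_mul h]
    simp
  simp only [normSqMix, Finset.sum_apply, Pi.mul_apply]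
  refine Finset.sum_congr rfl fun A _ => ?_
  rw [Finset.sum_comm]
  refine Finset.sum_congr rfl fun B _ => ?_
  rw [← h1 A B, Finset.mul_sum, Finset.sum_comm]
  refine Finset.sum_congr rfl fun B' _ => ?_
  simp only [Finset.mul_sum]
  exact Finset.sum_congr rfl fun A' _ => by ring

end Metric

/-! ### The scale factor -/

namespace IsScaleFactor

variable {a : ℝ → ℝ} {T t : ℝ}

theorem hasDerivWithinAt (ha : IsScaleFactor a T) (ht : t ∈ Ico 0 T) :
    HasDerivWithinAt a (derivWithin a (Ico 0 T) t) (Ico 0 T) t :=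
  (ha.contDiff.differentiableOn (by norm_num) t ht).hasDerivWithinAt

theorem hasDerivWithinAt_deriv (ha : IsScaleFactor a T) (ht : t ∈ Ico 0 T) :
    HasDerivWithinAt (derivWithin a (Ico 0 T)) (-(2 / 3) * a t ^ (1 / 3 : ℝ)) (Ico 0 T) t := by
  rw [← ha.ode t ht]
  exact ((ha.contDiff.derivWithin (m := 1) (uniqueDiffOn_Ico 0 T) (by norm_num)).differentiableOn
    (by norm_num) t ht).hasDerivWithinAt

/-- a'' is negative because a is positive, and a' starts from 0. -/
theorem deriv_nonpos (ha : IsScaleFactor a T) (ht : t ∈ Ico 0 T) :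
    derivWithin a (Ico 0 T) t ≤ 0 := by
  have hanti : AntitoneOn (derivWithin a (Ico 0 T)) (Ico 0 T) := by
    refine antitoneOn_of_hasDerivWithinAt_nonpos (convex_Ico 0 T)
      (f' := fun t => -(2 / 3) * a t ^ (1 / 3 : ℝ))
      (fun s hs => (ha.hasDerivWithinAt_deriv hs).continuousWithinAt)
      (fun s hs => (ha.hasDerivWithinAt_deriv (interior_subset hs)).mono interior_subset)
      fun s hs => ?_
    have := Real.rpow_pos_of_pos (ha.pos s (interior_subset hs)) (1 / 3 : ℝ)
    linarith
  have h0 : (0 : ℝ) ∈ Ico 0 T := ⟨le_rfl, ht.1.trans_lt ht.2⟩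
  have := hanti h0 ht ht.1
  rwa [ha.init_deriv] at this

/-- The Friedmann equation. -/
theorem friedmann (ha : IsScaleFactor a T) (ht : t ∈ Ico 0 T) :
    derivWithin a (Ico 0 T) t ^ 2 = 1 - a t ^ (4 / 3 : ℝ) := by
  -- A conserved energy: its derivative is 2 a' a'' + (4/3) a^{1/3} a' = 0, and its initial value is
  -- 1.
  set h : ℝ → ℝ := fun t => derivWithin a (Ico 0 T) t ^ 2 + a t ^ (4 / 3 : ℝ) with hh
  have hd : ∀ s ∈ Ico 0 T, HasDerivWithinAt h 0 (Ico 0 T) s := by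
    intro s hs
    have h1 := (ha.hasDerivWithinAt_deriv hs).pow 2
    have h2 := (ha.hasDerivWithinAt hs).rpow_const (p := 4 / 3) (Or.inl (ha.pos s hs).ne')
    refine (h1.add h2).congr_deriv ?_
    norm_num
    ring
  have h0 : (0 : ℝ) ∈ Ico 0 T := ⟨le_rfl, ht.1.trans_lt ht.2⟩
  have hc : h t = h 0 := by
    have h1 := (convex_Ico 0 T).norm_image_sub_le_of_norm_hasDerivWithin_le (C := 0) hd
      (fun s _ => by simp) h0 ht
    rw [zero_mul] at h1
    exact sub_eq_zero.mp (norm_le_zero_iff.mp h1)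
  simp only [hh, ha.init_deriv, ha.init, Real.one_rpow] at hc
  linarith

end IsScaleFactor

/-! ### The commuted equations -/

section Rules

variable {t : ℝ} {f g : Scalar} {I : List (Fin 3)}

theorem zI_add (hf : Sm I.length t f) (hg : Sm I.length t g) :
    zI I (f + g) t = zI I f t + zI I g t :=
  (isLieOp_dZ t).opI_add I hf hg

theorem zI_smul (I : List (Fin 3)) (c : ℝ) (f : Scalar) : zI I (c • f) t = c • zI I f t :=
  (isLieOp_dZ t).opI_smul I c f

theorem lieFormI_add {ξ η : Tensor1} (hξ : Sm1 t I.length ξ) (hη : Sm1 t I.length η)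
    (A : Fin 3) : lieFormI I (ξ + η) A t = lieFormI I ξ A t + lieFormI I η A t :=
  congrFun ((isLieOp_lieForm t).opI_add I hξ hη) A

theorem lieFormI_smul (I : List (Fin 3)) (c : ℝ) (ξ : Tensor1) (A : Fin 3) :
    lieFormI I (c • ξ) A t = c • lieFormI I ξ A t :=
  congrFun ((isLieOp_lieForm t).opI_smul I c ξ) A

theorem Sm.zI {k : ℕ} (hf : Sm (k + I.length) t f) : Sm k t (zI I f) :=
  (isLieOp_dZ t).opI_reg I hf

theorem Sm1.lieFormI {k : ℕ} {ξ : Tensor1} (hξ : Sm1 t (k + I.length) ξ) :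
    Sm1 t k (lieFormI I ξ) :=
  (isLieOp_lieForm t).opI_reg I hξ

end Rules

theorem apow_apply (a : ℝ → ℝ) (p t : ℝ) (x : S3) : apow a p t x = a t ^ p := rfl

theorem aprime_apply (a : ℝ → ℝ) (T t : ℝ) (x : S3) :
    aprime a T t x = derivWithin a (Ico 0 T) t := rfl

/-- Expressing every weight through b = a^{1/3} makes the later identities polynomial; a⁻¹ enters
only through its relation to b³. -/
theorem rpow_thirds {a : ℝ} (ha : 0 < a) :
    a ^ (4 / 3 : ℝ) = (a ^ (1 / 3 : ℝ)) ^ 4 ∧ a ^ (5 / 3 : ℝ) = (a ^ (1 / 3 : ℝ)) ^ 5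
    ∧ a ^ (8 / 3 : ℝ) = (a ^ (1 / 3 : ℝ)) ^ 8 ∧ a ^ (3 : ℝ) = (a ^ (1 / 3 : ℝ)) ^ 9
    ∧ a ^ (-1 : ℝ) * (a ^ (1 / 3 : ℝ)) ^ 3 = 1 := by
  simp only [← Real.rpow_natCast, ← Real.rpow_mul ha.le, ← Real.rpow_add ha]
  norm_num

namespace IsSolution

variable {a : ℝ → ℝ} {T t : ℝ} {m k : ℕ} {u : Fields} {I : List (Fin 3)} {x : S3}

theorem posDef_gram (hu : IsSolution a T m u) (ht : t ∈ Ico 0 T) (x : S3) :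
    (gramMatrix u.G t x).PosDef := hu.posDef t ht x

theorem reg_invMetric (hu : IsSolution a T m u) (A B : Fin 3) :
    IsCk m T (invMetric u.G A B) :=
  IsCk.invMetric hu.reg_G (fun _ ht x => hu.posDef_gram ht x) A B

theorem sm_G (hu : IsSolution a T m u) (ht : t ∈ Ico 0 T) (hk : k ≤ m) : Sm2 t k u.G :=
  fun A B => ((hu.reg_G A B).sm ht).mono hk

theorem sm_K (hu : IsSolution a T m u) (ht : t ∈ Ico 0 T) (hk : k ≤ m) : Sm2 t k u.K :=
  fun A B => ((hu.reg_K A B).sm ht).mono hk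

theorem sm_invMetric (hu : IsSolution a T m u) (ht : t ∈ Ico 0 T) (hk : k ≤ m) :
    Sm2 t k (invMetric u.G) :=
  fun A B => ((hu.reg_invMetric A B).sm ht).mono hk

theorem sm_lapse (hu : IsSolution a T m u) (ht : t ∈ Ico 0 T) (hk : k ≤ m) : Sm k t u.lapse :=
  (hu.reg_lapse.sm ht).mono hk

theorem sm_timeSf (hu : IsSolution a T m u) (ht : t ∈ Ico 0 T) (hk : k ≤ m) : Sm k t u.timeSf :=
  (hu.reg_timeSf.sm ht).mono hk

theorem sm_spaceSf (hu : IsSolution a T m u) (ht : t ∈ Ico 0 T) (hk : k ≤ m) :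
    Sm1 t k u.spaceSf :=
  fun A => ((hu.reg_spaceSf A).sm ht).mono hk

/-- The commuted wave equation. -/
theorem dt_zI_timeSf (hu : IsSolution a T m u) (hm : I.length + 2 ≤ m) (hpos : 0 < a t)
    (ht : t ∈ Ico 0 T) (x : S3) :
    dt T (zI I u.timeSf) t x
      = a t ^ (1 / 3 : ℝ) * (fullLapse a u t x * divForm u.G (lieFormI I u.spaceSf) t x)
        - κ * derivWithin a (Ico 0 T) t * a t ^ (1 / 3 : ℝ) * zI I u.lapse t x
        + a t ^ (1 / 3 : ℝ) * (timeSfBorder a T u I t x + timeSfJunk a T u I t x) := by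
  obtain ⟨h43, h53, -⟩ := rpow_thirds hpos
  set b := a t ^ (1 / 3 : ℝ) with hb
  set a' := derivWithin a (Ico 0 T) t with ha'
  have hψ : Sm (I.length + 1) t u.lapse := hu.sm_lapse ht (by omega)
  have hψ0 : Sm I.length t u.lapse := hu.sm_lapse ht (by omega)
  have hP0 : Sm I.length t u.timeSf := hu.sm_timeSf ht (by omega)
  have hI0 : Sm2 t I.length (invMetric u.G) := hu.sm_invMetric ht (by omega)
  have hω0 : Sm1 t I.length u.spaceSf := hu.sm_spaceSf ht (by omega)
  have hdiv : Sm I.length t (divForm u.G u.spaceSf) :=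
    Sm.divForm (hu.sm_G ht (by omega)) (hu.sm_invMetric ht (by omega)) (hu.sm_spaceSf ht (by omega))
  -- The index is raised on the one-form `spaceSf` instead of on ∇lapse, matching the shape of the
  -- triple sum in `timeSfJunk`.
  set Q : Scalar := ∑ A, grad u.lapse A * ∑ B, invMetric u.G A B * u.spaceSf B with hQ
  have hQ0 : Sm I.length t Q :=
    Sm.sum fun A _ => (hψ.dZ A).mul (Sm.sum fun B _ => (hI0 A B).mul (hω0 B))
  -- On a fixed slice the functions of time are numbers, so Z^I passes through them by linearity and
  -- only the products of fields need a Leibniz rule.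
  have hrhs : dt T u.timeSf t = (b • divForm u.G u.spaceSf
      + (b ^ 5 • (u.lapse * divForm u.G u.spaceSf)
      + ((-(κ * a' * b)) • u.lapse + ((-(b * a')) • (u.lapse * u.timeSf) + b ^ 5 • Q)))) t := by
    funext x
    rw [hu.evol_timeSf t ht x]
    have hc : contract u.spaceSf (sharp u.G (grad u.lapse)) t x = Q t x := by
      have hs := invMetric_symm (hu.posDef_gram ht x)
      simp only [hQ, contract, sharp, Finset.sum_apply, Pi.mul_apply, Finset.mul_sum]
      rw [Finset.sum_comm]
      refine Finset.sum_congr rfl fun A _ => Finset.sum_congr rfl fun B _ => ?_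
      rw [hs B A]
      ring
    simp only [Pi.add_apply, Pi.sub_apply, Pi.mul_apply, Pi.smul_apply, smul_eq_mul, fullLapse,
      Pi.one_apply, apow_apply, aprime_apply, hc, h43, h53]
    rw [← ha', ← hb]
    ring
  rw [dt_zI (hu.reg_timeSf.mono (by omega)) ht x, zI_congr I hrhs,
    zI_add (hdiv.smul _) (((hψ0.mul hdiv).smul _).add ((hψ0.smul _).add
      (((hψ0.mul hP0).smul _).add (hQ0.smul _)))),
    zI_add ((hψ0.mul hdiv).smul _) ((hψ0.smul _).add
      (((hψ0.mul hP0).smul _).add (hQ0.smul _))),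
    zI_add (hψ0.smul _) (((hψ0.mul hP0).smul _).add (hQ0.smul _)),
    zI_add ((hψ0.mul hP0).smul _) (hQ0.smul _)]
  simp only [zI_smul, Pi.add_apply, Pi.smul_apply, smul_eq_mul]
  -- The splitting (I, ∅) of the product lapse · timeSf is isolated: it is the borderline term, and
  -- the remaining splittings belong to the junk.
  rw [hQ, zI_contract_raise hψ hI0 hω0, zI_mul hψ0 hP0, sum_splits2_filter]
  simp only [timeSfBorder, timeSfJunk, fullLapse, Pi.add_apply, Pi.sub_apply, Pi.mul_apply,
    Pi.neg_apply, Pi.one_apply, apow_apply, aprime_apply, h43]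
  rw [← ha']
  change _ = _ + b * (-(a' * zI I u.lapse t x * u.timeSf t x) + _)
  simp only [opI, List.foldr_nil]
  ring

/-- The commuted evolution equation for the spatial derivatives of the scalar field. -/
theorem dt_lieFormI_spaceSf (hu : IsSolution a T m u) (hm : I.length + 2 ≤ m) (hpos : 0 < a t)
    (ht : t ∈ Ico 0 T) (A : Fin 3) (x : S3) :
    dt T (lieFormI I u.spaceSf A) t x
      = a t ^ (-1 : ℝ) * fullLapse a u t x * grad (zI I u.timeSf) A t x
        + κ * a t ^ (1 / 3 : ℝ) * grad (zI I u.lapse) A t x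
        + a t ^ (1 / 3 : ℝ) * (spaceSfBorder u I A t x + spaceSfJunk u I A t x) := by
  obtain ⟨h43, -, -, -, h1⟩ := rpow_thirds hpos
  set b := a t ^ (1 / 3 : ℝ) with hb
  set d := a t ^ (-1 : ℝ) with hd
  have hψ : Sm (I.length + 1) t u.lapse := hu.sm_lapse ht (by omega)
  have hP : Sm (I.length + 1) t u.timeSf := hu.sm_timeSf ht (by omega)
  have hψ0 : Sm I.length t u.lapse := hψ.mono (by omega)
  have hP0 : Sm I.length t u.timeSf := hP.mono (by omega)
  have hgψ : Sm1 t I.length (grad u.lapse) := fun A => hψ.dZ A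
  have hgP : Sm1 t I.length (grad u.timeSf) := fun A => hP.dZ A
  set V : Tensor1 := fun C => u.lapse * grad u.timeSf C with hV
  set W : Tensor1 := fun C => u.timeSf * grad u.lapse C with hW
  have hV0 : Sm1 t I.length V := fun A => hψ0.mul (hgP A)
  have hW0 : Sm1 t I.length W := fun A => hP0.mul (hgψ A)
  have hs : ∀ {ξ : Tensor1} (c : ℝ), Sm1 t I.length ξ → Sm1 t I.length (c • ξ) :=
    fun c h A => (h A).smul c
  have hadd : ∀ {ξ η : Tensor1}, Sm1 t I.length ξ → Sm1 t I.length η → Sm1 t I.length (ξ + η) :=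
    fun h h' A => (h A).add (h' A)
  have hrhs : ∀ A, dt T (u.spaceSf A) t
      = (d • grad u.timeSf + (b • V + ((κ * b) • grad u.lapse + b • W))) A t := by
    intro A
    funext x
    rw [hu.evol_spaceSf t ht x A]
    simp only [Pi.add_apply, Pi.mul_apply, Pi.smul_apply, smul_eq_mul, fullLapse,
      Pi.one_apply, apow_apply, h43, hV, hW]
    rw [← hb, ← hd]
    -- The relation used is a⁻¹ a^{4/3} = a^{1/3}, applied to the lapse part of n.
    linear_combination (b * u.lapse t x * grad u.timeSf A t x) * h1
  rw [dt_lieFormI (fun A => (hu.reg_spaceSf A).mono (by omega)) ht A x,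
    lieFormI_congr (ξ := fun B => dt T (u.spaceSf B)) I hrhs,
    lieFormI_add (hs _ hgP) (hadd (hs _ hV0) (hadd (hs _ hgψ) (hs _ hW0))),
    lieFormI_add (hs _ hV0) (hadd (hs _ hgψ) (hs _ hW0)),
    lieFormI_add (hs _ hgψ) (hs _ hW0)]
  simp only [lieFormI_smul, Pi.add_apply, Pi.smul_apply, smul_eq_mul, lieFormI_grad hψ,
    lieFormI_grad hP, spaceSfBorder, spaceSfJunk, fullLapse, Pi.one_apply, apow_apply,
    Pi.mul_apply, Pi.sub_apply, h43]
  rw [← hV, ← hW]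
  linear_combination (-(b * u.lapse t x * grad (zI I u.timeSf) A t x)) * h1

theorem normSqMix_eq (hu : IsSolution a T m u) (ht : t ∈ Ico 0 T) :
    normSqMix u.G u.K t = (∑ A, ∑ B, u.K A B * u.K B A) t :=
  funext fun x => normSqMix_eq_trace (hu.posDef_gram ht x) (hu.symm t ht x)

/-- The commuted elliptic lapse equation. -/
theorem lap_zI_lapse (hu : IsSolution a T m u) (hm : I.length + 2 ≤ m) (hpos : 0 < a t)
    (ht : t ∈ Ico 0 T) (x : S3) :
    a t ^ (8 / 3 : ℝ) * lap u.G (zI I u.lapse) t x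
      = a t ^ (4 / 3 : ℝ) * ellF a T u t x * zI I u.lapse t x + 2 * κ * zI I u.timeSf t x
        + lapseHighBorder u I t x + a t ^ (4 / 3 : ℝ) * lapseHighJunk a u I t x := by
  obtain ⟨h43, -, h83, -⟩ := rpow_thirds hpos
  set b := a t ^ (1 / 3 : ℝ) with hb
  set a' := derivWithin a (Ico 0 T) t with ha'
  have hψ : Sm I.length t u.lapse := hu.sm_lapse ht (by omega)
  have hP : Sm I.length t u.timeSf := hu.sm_timeSf ht (by omega)
  have hK : Sm2 t I.length u.K := hu.sm_K ht (by omega)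
  have htr : Sm I.length t (∑ A, ∑ B, u.K A B * u.K B A) :=
    Sm.sum fun A _ => Sm.sum fun B _ => (hK A B).mul (hK B A)
  have hN : Sm I.length t (normSqMix u.G u.K) := htr.congr (hu.normSqMix_eq ht)
  have hψ2 : Sm (I.length + 2) t u.lapse := hu.sm_lapse ht (by omega)
  have hlap : Sm I.length t (lap u.G u.lapse) :=
    Sm.divForm (hu.sm_G ht (by omega)) (hu.sm_invMetric ht (by omega))
      (fun A => hψ2.dZ A)
  have hN1 := hN.mul hψ
  have hP1 := hP.mul hψ
  have hP2 := (hP.pow 2).mul hψ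
  have hPP := hP.mul hP
  -- |K|² is replaced by tr K² only in the source. The coefficient of the lapse keeps |K|², since
  -- the junk contains the commutator with multiplication by |K|² while the border is a sum of
  -- traces.
  have heq : (b ^ 8 • lap u.G u.lapse) t
      = ((b ^ 4 * (a' ^ 2 + 2 / 3 * b ^ 4)) • u.lapse + (b ^ 4 • (normSqMix u.G u.K * u.lapse)
        + ((b ^ 4 * (2 * κ)) • (u.timeSf * u.lapse) + (b ^ 4 • (u.timeSf ^ 2 * u.lapse)
        + ((2 * κ) • u.timeSf + (∑ A, ∑ B, u.K A B * u.K B A + u.timeSf * u.timeSf)))))) t := by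
    funext x
    have h := hu.ell t ht x
    simp only [ellL, ellF, Pi.add_apply, Pi.sub_apply, Pi.mul_apply, Pi.smul_apply, Pi.pow_apply,
      smul_eq_mul, apow_apply, aprime_apply, h43, h83] at h
    rw [← ha'] at h
    have h2 := congrFun (hu.normSqMix_eq ht) x
    simp only [Pi.add_apply, Pi.mul_apply, Pi.smul_apply, Pi.pow_apply, smul_eq_mul]
    linear_combination h + h2
  have hz := congrFun (zI_congr I heq) x
  rw [zI_smul, zI_add (hψ.smul _) ((hN1.smul _).add ((hP1.smul _).add ((hP2.smul _).add
      ((hP.smul _).add (htr.add hPP))))),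
    zI_add (hN1.smul _) ((hP1.smul _).add ((hP2.smul _).add ((hP.smul _).add (htr.add hPP)))),
    zI_add (hP1.smul _) ((hP2.smul _).add ((hP.smul _).add (htr.add hPP))),
    zI_add (hP2.smul _) ((hP.smul _).add (htr.add hPP)),
    zI_add (hP.smul _) (htr.add hPP), zI_add htr hPP] at hz
  simp only [zI_smul, Pi.add_apply, Pi.smul_apply, smul_eq_mul] at hz
  rw [zI_trace hK hK, zI_mul hP hP] at hz
  simp only [lapseHighBorder, lapseHighJunk, commMul, ellF, Pi.add_apply, Pi.sub_apply,
    Pi.mul_apply, Pi.smul_apply, Pi.pow_apply, smul_eq_mul, apow_apply, aprime_apply, h43, h83]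
  rw [← ha']
  linear_combination hz

end IsSolution

/-! ### The divergence identity -/

section Algebra

variable {G : Tensor2} {t : ℝ} {x : S3}

theorem contract_sharp_self (G : Tensor2) (ξ : Tensor1) :
    contract ξ (sharp G ξ) t x = normSqForm G ξ t x := by
  simp only [contract, sharp, normSqForm, Finset.sum_apply, Pi.mul_apply, Finset.mul_sum]
  exact Finset.sum_congr rfl fun A _ => Finset.sum_congr rfl fun B _ => by ring

theorem contract_sharp_apply (ξ ω : Tensor1) :
    contract ξ (sharp G ω) t x = ∑ A, ξ A t x * sharp G ω A t x := by
  simp only [contract, Finset.sum_apply, Pi.mul_apply]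

theorem sum_mul_sharp_symm (h : (gramMatrix G t x).PosDef) (ξ : Fin 3 → ℝ) (ω : Tensor1) :
    ∑ A, ∑ B, invMetric G A B t x * (ξ A * ω B t x + ω A t x * ξ B)
      = 2 * ∑ A, ξ A * sharp G ω A t x := by
  have hs := invMetric_symm h
  simp only [mul_add, Finset.sum_add_distrib, sharp, Finset.sum_apply, Pi.mul_apply,
    Finset.mul_sum, two_mul]
  congr 1
  · exact Finset.sum_congr rfl fun A _ => Finset.sum_congr rfl fun B _ => by ring
  · rw [Finset.sum_comm]
    exact Finset.sum_congr rfl fun A _ => Finset.sum_congr rfl fun B _ => by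
      rw [hs B A]; ring

end Algebra

variable {a : ℝ → ℝ} {T t : ℝ} {m k : ℕ} {u : Fields} {I : List (Fin 3)} {x : S3}

theorem dt_normSqForm {G : Tensor2} (h : (gramMatrix G t x).PosDef)
    (hI : ∀ A B, IsCk 1 T (invMetric G A B)) {ω : Tensor1} (hω : ∀ A, IsCk 1 T (ω A))
    (ht : t ∈ Ico 0 T) :
    HasDerivWithinAt (fun s => normSqForm G ω s x)
      ((∑ A, ∑ B, dt T (invMetric G A B) * ω A * ω B) t x
        + 2 * ∑ A, dt T (ω A) t x * sharp G ω A t x) (Ico 0 T) t := by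
  have h1 : HasDerivWithinAt (fun s => ∑ A, ∑ B, invMetric G A B s x * ω A s x * ω B s x)
      (∑ A, ∑ B, ((dt T (invMetric G A B) t x * ω A t x + invMetric G A B t x * dt T (ω A) t x)
        * ω B t x + invMetric G A B t x * ω A t x * dt T (ω B) t x)) (Ico 0 T) t :=
    HasDerivWithinAt.fun_sum fun A _ => HasDerivWithinAt.fun_sum fun B _ =>
      (((hI A B).hasDerivWithinAt le_rfl ht x).mul ((hω A).hasDerivWithinAt le_rfl ht x)).mul
        ((hω B).hasDerivWithinAt le_rfl ht x)
  have h2 : (fun s => normSqForm G ω s x)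
      = fun s => ∑ A, ∑ B, invMetric G A B s x * ω A s x * ω B s x := by
    funext s
    simp only [normSqForm, Finset.sum_apply, Pi.mul_apply]
  rw [h2]
  refine h1.congr_deriv ?_
  rw [← sum_mul_sharp_symm h (fun A => dt T (ω A) t x)]
  simp only [Finset.sum_apply, Pi.mul_apply, ← Finset.sum_add_distrib]
  exact Finset.sum_congr rfl fun A _ => Finset.sum_congr rfl fun B _ => by ring

/-- The trace of `∂_t G`; the contribution of the trace-free `K` drops out. -/
theorem IsSolution.trace_dt_G (hu : IsSolution a T m u) (ht : t ∈ Ico 0 T) (x : S3) :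
    (1 / 2) * ∑ A, ∑ C, invMetric u.G C A t x * dt T (u.G A C) t x
      = a t ^ (1 / 3 : ℝ) * derivWithin a (Ico 0 T) t * u.lapse t x := by
  have h := hu.posDef_gram ht x
  have htr := hu.traceFree t ht x
  rw [Finset.sum_apply, Finset.sum_apply] at htr
  have h1 : ∑ A, ∑ C, invMetric u.G C A t x * (∑ E, u.G A E t x * u.K E C t x) = 0 := by
    rw [Finset.sum_comm]
    rw [← htr]
    refine Finset.sum_congr rfl fun C _ => ?_
    simp only [Finset.mul_sum, ← mul_assoc]
    rw [Finset.sum_comm]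
    simp only [← Finset.sum_mul, invMetric_mul h]
    simp
  have h2 : ∑ A, ∑ C, invMetric u.G C A t x * u.G A C t x = 3 := by
    rw [Finset.sum_comm]
    simp only [invMetric_mul h]
    simp
  have h3 : ∑ A, ∑ C, invMetric u.G C A t x * dt T (u.G A C) t x
      = (-(2 * a t ^ (-1 : ℝ)) - 2 * a t ^ (1 / 3 : ℝ) * u.lapse t x)
          * (∑ A, ∑ C, invMetric u.G C A t x * (∑ E, u.G A E t x * u.K E C t x))
        + (2 / 3 * (a t ^ (1 / 3 : ℝ) * derivWithin a (Ico 0 T) t * u.lapse t x))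
          * ∑ A, ∑ C, invMetric u.G C A t x * u.G A C t x := by
    rw [Finset.mul_sum, Finset.mul_sum, ← Finset.sum_add_distrib]
    refine Finset.sum_congr rfl fun A _ => ?_
    rw [Finset.mul_sum, Finset.mul_sum, ← Finset.sum_add_distrib]
    refine Finset.sum_congr rfl fun C _ => ?_
    rw [hu.evol_G t ht x A C]
    simp only [Pi.add_apply, Pi.sub_apply, Pi.neg_apply, Pi.mul_apply, Pi.smul_apply,
      Finset.sum_apply, smul_eq_mul, apow_apply, aprime_apply, Pi.ofNat_apply]
    ring
  rw [h3, h1, h2]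
  ring

/-- The divergence of the current before the field equations are used. -/
theorem IsSolution.divST_sfCurrent (ha : IsScaleFactor a T) (hu : IsSolution a T m u)
    (hm : 2 ≤ m) {P : Scalar} {ω : Tensor1} (hP : IsCk 1 T P) (hω : ∀ A, IsCk 1 T (ω A))
    (ht : t ∈ Ico 0 T) (x : S3) :
    divST T u.G (sfCurrent a u P ω) t x
      = 2 * P t x * dt T P t x
        + 4 / 3 * a t ^ (1 / 3 : ℝ) * derivWithin a (Ico 0 T) t * normSqForm u.G ω t x
        + a t ^ (4 / 3 : ℝ) * ((∑ A, ∑ B, dt T (invMetric u.G A B) * ω A * ω B) t x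
          + 2 * ∑ A, dt T (ω A) t x * sharp u.G ω A t x)
        + a t ^ (1 / 3 : ℝ) * derivWithin a (Ico 0 T) t * u.lapse t x
          * (P t x ^ 2 + a t ^ (4 / 3 : ℝ) * normSqForm u.G ω t x)
        - 2 * a t ^ (1 / 3 : ℝ) * (fullLapse a u t x * P t x * divForm u.G ω t x
          + fullLapse a u t x * contract (grad P) (sharp u.G ω) t x
          + a t ^ (4 / 3 : ℝ) * P t x * contract (grad u.lapse) (sharp u.G ω) t x) := by
  have hpd := hu.posDef_gram ht
  have hG1 : Sm2 t 1 u.G := hu.sm_G ht (by omega)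
  have hI1 : Sm2 t 1 (invMetric u.G) := hu.sm_invMetric ht (by omega)
  have hψ1 : Sm 1 t u.lapse := hu.sm_lapse ht (by omega)
  have hω1 : Sm1 t 1 ω := fun A => (hω A).sm ht
  have hP1 : Sm 1 t P := hP.sm ht
  have hS1 : Sm1 t 1 (sharp u.G ω) := fun A => Sm.sum fun B _ => (hI1 A B).mul (hω1 B)
  have hpos := ha.pos t ht
  have h0 : dt T (sfCurrent a u P ω (.inl ())) t x
      = 2 * P t x * dt T P t x
        + 4 / 3 * a t ^ (1 / 3 : ℝ) * derivWithin a (Ico 0 T) t * normSqForm u.G ω t x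
        + a t ^ (4 / 3 : ℝ) * ((∑ A, ∑ B, dt T (invMetric u.G A B) * ω A * ω B) t x
          + 2 * ∑ A, dt T (ω A) t x * sharp u.G ω A t x) := by
    have h1 := (hP.hasDerivWithinAt le_rfl ht x).pow 2
    have h2 := (ha.hasDerivWithinAt ht).rpow_const (p := 4 / 3) (Or.inl hpos.ne')
    have h3 := dt_normSqForm (hpd x) (fun A B => (hu.reg_invMetric A B).mono (by omega)) hω ht
    refine dt_eq_of_hasDerivWithinAt ((h1.add (h2.mul h3)).congr_deriv ?_) ht
    norm_num
    ring
  have hdiv : divG u.G (fun A => sfCurrent a u P ω (.inr A)) t x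
      = -(2 * a t ^ (1 / 3 : ℝ) * (fullLapse a u t x * P t x * divForm u.G ω t x
          + fullLapse a u t x * contract (grad P) (sharp u.G ω) t x
          + a t ^ (4 / 3 : ℝ) * P t x * contract (grad u.lapse) (sharp u.G ω) t x)) := by
    set c := a t ^ (1 / 3 : ℝ) with hc
    set d := a t ^ (4 / 3 : ℝ) with hd
    -- The spatial flux is f ω^#, with the weights frozen at time t, so its divergence follows from
    -- the product rule and `divG_sharp`.
    set f : Scalar := (-(2 * c)) • P + (-(2 * c * d)) • (u.lapse * P) with hf
    have he : ∀ A, (fun A => sfCurrent a u P ω (.inr A)) A t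
        = (fun A => f * sharp u.G ω A : Tensor1) A t := by
      intro A
      funext y
      simp only [sfCurrent, hf, fullLapse, Pi.neg_apply, Pi.mul_apply, Pi.add_apply,
        Pi.smul_apply, Pi.ofNat_apply, smul_eq_mul, apow_apply]
      rw [← hc, ← hd]
      ring
    have hf1 : Sm 1 t f := (hP1.smul _).add ((hψ1.mul hP1).smul _)
    rw [divG_congr he, divG_smul hf1 hS1, divG_sharp hG1 hI1 hpd hω1]
    have hdf : ∀ A, dZ A f t x = -(2 * c) * (1 + d * u.lapse t x) * dZ A P t x
        + -(2 * c * d) * P t x * dZ A u.lapse t x := by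
      intro A
      rw [hf, dZ_add (hP1.smul _) ((hψ1.mul hP1).smul _), dZ_smul, dZ_smul]
      simp only [Pi.add_apply, Pi.smul_apply, smul_eq_mul, dZ_mul hψ1 hP1, Pi.mul_apply]
      ring
    simp only [hdf, add_mul, Finset.sum_add_distrib, mul_assoc, ← Finset.mul_sum]
    simp only [contract_sharp_apply, hf, fullLapse, grad, Pi.mul_apply, Pi.add_apply,
      Pi.smul_apply, Pi.one_apply, smul_eq_mul, apow_apply]
    rw [← hd]
    ring
  rw [divST_eq (hpd x), hdiv, h0, hu.trace_dt_G ht x]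
  simp only [sfCurrent, Pi.add_apply, Pi.mul_apply, Pi.pow_apply, apow_apply]
  ring

/-- The divergence of `(∇^# f) f`. -/
theorem IsSolution.divG_sharp_grad_mul (hu : IsSolution a T m u) (hm : 2 ≤ m) {f : Scalar}
    (hf : Sm 2 t f) (ht : t ∈ Ico 0 T) (x : S3) :
    divG u.G (fun A => sharp u.G (grad f) A * f) t x
      = f t x * lap u.G f t x + normSqForm u.G (grad f) t x := by
  have hpd := hu.posDef_gram ht
  have hG1 : Sm2 t 1 u.G := hu.sm_G ht (by omega)
  have hI1 : Sm2 t 1 (invMetric u.G) := hu.sm_invMetric ht (by omega)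
  have hg : Sm1 t 1 (grad f) := fun A => hf.dZ A
  have hS1 : Sm1 t 1 (sharp u.G (grad f)) := fun A => Sm.sum fun B _ => (hI1 A B).mul (hg B)
  simp only [mul_comm _ f]
  rw [divG_smul (hf.mono (by omega)) hS1, divG_sharp hG1 hI1 hpd hg,
    ← contract_sharp_self, contract_sharp_apply]
  rfl

/-- This is the coefficient produced by multiplying a^{4/3} f ψ in the elliptic equation by a'
a^{1/3} ψ; the factorization also reduces the sign of c to those of a' and f. -/
theorem lapseCoeff_eq (hpos : 0 < a t) :
    lapseCoeff a T u t x
      = derivWithin a (Ico 0 T) t * a t ^ (5 / 3 : ℝ) * ellF a T u t x := by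
  obtain ⟨h43, h53, -, h3, -⟩ := rpow_thirds hpos
  simp only [lapseCoeff, ellF, Pi.add_apply, Pi.mul_apply, Pi.smul_apply, Pi.pow_apply,
    smul_eq_mul, apow_apply, aprime_apply, h43, h53, h3]
  ring

/-- The zeroth order coefficient of the elliptic lapse operator is nonnegative. -/
theorem IsSolution.ellF_nonneg (ha : IsScaleFactor a T) (hu : IsSolution a T m u)
    (ht : t ∈ Ico 0 T) (x : S3) : 0 ≤ ellF a T u t x := by
  have h1 := normSqMix_nonneg (hu.posDef_gram ht x) u.K
  have h2 := ha.friedmann ht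
  have h3 : κ ^ 2 = 2 / 3 := Real.sq_sqrt (by norm_num)
  simp only [ellF, Pi.add_apply, Pi.smul_apply, Pi.pow_apply, smul_eq_mul, apow_apply,
    aprime_apply]
  -- The Friedmann equation turns (a')² + (2/3) a^{4/3} into (a')²/3 + 2/3, and 2/3 = κ² completes
  -- the square (P + κ)².
  nlinarith [sq_nonneg (u.timeSf t x + κ), sq_nonneg (derivWithin a (Ico 0 T) t)]

end ScalarFieldCurrent

end

/-! ### Assembly of the identity and the signs -/

/-- Divergence identity for the scalar field energy current combined with the lapse, for every
multi-index `I`, together with the signs of the quadratic terms. -/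
theorem lemma10p4 (a : ℝ → ℝ) (T : ℝ) (ha : IsScaleFactor a T)
    (I : List (Fin 3)) (m : ℕ) (hm : I.length + 2 ≤ m)
    (u : Fields) (hu : IsSolution a T m u)
    (t : ℝ) (ht : t ∈ Set.Ico 0 T) (x : S3) :
    (divST T u.G (sfCurrent a u (zI I u.timeSf) (lieFormI I u.spaceSf))
        + aprime a T * apow a 3
          * divG u.G (fun A => sharp u.G (grad (zI I u.lapse)) A * zI I u.lapse)) t x
      = ((4 / 3 : ℝ) • (aprime a T * apow a (1 / 3) * normSqForm u.G (lieFormI I u.spaceSf))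
        + aprime a T * apow a 3 * normSqForm u.G (grad (zI I u.lapse))
        + lapseCoeff a T u * zI I u.lapse ^ 2
        + (2 * κ) • (apow a (5 / 3)
            * contract (grad (zI I u.lapse)) (sharp u.G (lieFormI I u.spaceSf)))
        + sfCurrentBorder a T u I + sfCurrentJunk a T u I) t x
    ∧ ((4 / 3 : ℝ) • (aprime a T * apow a (1 / 3)
          * normSqForm u.G (lieFormI I u.spaceSf))) t x ≤ 0
    ∧ (aprime a T * apow a 3 * normSqForm u.G (grad (zI I u.lapse))) t x ≤ 0
    ∧ lapseCoeff a T u t x ≤ 0 := by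
  have hpos := ha.pos t ht
  have hpd := hu.posDef_gram ht x
  have ha' := ha.deriv_nonpos ht
  have hb : 0 < a t ^ (1 / 3 : ℝ) := Real.rpow_pos_of_pos hpos _
  refine ⟨?_, ?_, ?_, ?_⟩
  · have hP1 : IsCk 1 T (zI I u.timeSf) := IsCk.zI (hu.reg_timeSf.mono (by omega))
    have hω1 : ∀ A, IsCk 1 T (lieFormI I u.spaceSf A) :=
      IsCk.lieFormI fun A => (hu.reg_spaceSf A).mono (by omega)
    have hψ2 : Sm 2 t (zI I u.lapse) := Sm.zI (hu.sm_lapse ht (by omega))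
    have hωdt : ∑ A, dt T (lieFormI I u.spaceSf A) t x * sharp u.G (lieFormI I u.spaceSf) A t x
        = a t ^ (-1 : ℝ) * fullLapse a u t x
            * contract (grad (zI I u.timeSf)) (sharp u.G (lieFormI I u.spaceSf)) t x
          + κ * a t ^ (1 / 3 : ℝ)
            * contract (grad (zI I u.lapse)) (sharp u.G (lieFormI I u.spaceSf)) t x
          + a t ^ (1 / 3 : ℝ)
            * (contract (spaceSfBorder u I) (sharp u.G (lieFormI I u.spaceSf)) t x
              + contract (spaceSfJunk u I) (sharp u.G (lieFormI I u.spaceSf)) t x) := by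
      simp only [hu.dt_lieFormI_spaceSf hm hpos ht, contract_sharp_apply, add_mul, mul_add,
        Finset.sum_add_distrib, mul_assoc, ← Finset.mul_sum]
    have hell := hu.lap_zI_lapse hm hpos ht x
    have hdiv := hu.divST_sfCurrent ha (by omega) hP1 hω1 ht x
    rw [hωdt, hu.dt_zI_timeSf hm hpos ht x] at hdiv
    rw [Pi.add_apply, Pi.add_apply, hdiv]
    simp only [Pi.add_apply, Pi.sub_apply, Pi.mul_apply, Pi.smul_apply, Pi.pow_apply, smul_eq_mul,
      Pi.ofNat_apply, sfCurrentBorder, sfCurrentJunk, lapseCoeff_eq hpos,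
      hu.divG_sharp_grad_mul (by omega) hψ2 ht x, apow_apply, aprime_apply]
    obtain ⟨h43, h53, h83, h3, h1⟩ := rpow_thirds hpos
    rw [h83, h43] at hell
    rw [h43, h53, h3]
    set b := a t ^ (1 / 3 : ℝ)
    -- The elliptic equation is multiplied by a' a^{1/3} Z^Iψ to cancel the mixed lapse–P term. The
    -- second multiple uses a^{4/3} a⁻¹ = a^{1/3} to cancel ∇Z^I P · (L^I ω)^# between the time
    -- derivative and the flux.
    linear_combination (derivWithin a (Set.Ico 0 T) t * b * zI I u.lapse t x) * hell
      + (2 * b * fullLapse a u t x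
        * contract (grad (zI I u.timeSf)) (sharp u.G (lieFormI I u.spaceSf)) t x) * h1
  · have h1 := normSqForm_nonneg hpd (lieFormI I u.spaceSf)
    simp only [Pi.mul_apply, Pi.smul_apply, smul_eq_mul, apow_apply, aprime_apply]
    have := mul_nonneg hb.le h1
    nlinarith [mul_nonneg_of_nonpos_of_nonpos ha' (neg_nonpos.mpr this)]
  · have h1 := normSqForm_nonneg hpd (grad (zI I u.lapse))
    simp only [Pi.mul_apply, apow_apply, aprime_apply]
    exact mul_nonpos_of_nonpos_of_nonneg
      (mul_nonpos_of_nonpos_of_nonneg ha' (Real.rpow_nonneg hpos.le _)) h1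
  · rw [lapseCoeff_eq hpos]
    exact mul_nonpos_of_nonpos_of_nonneg
      (mul_nonpos_of_nonpos_of_nonneg ha' (Real.rpow_nonneg hpos.le _)) (hu.ellF_nonneg ha ht x)
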